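/- All tensor products $\otimes$ of C*-algebras are spatial (minimal), $\iota$ is the identity map and $I$ the unit. A compact quantum group $G=(\mathcal A,\Delta)$ is a unital C*-algebra $\mathcal A$ with a unital $*$-homomorphism $\Delta:\mathcal A\to\mathcal A\otimes\mathcal A$ such that $(\Delta\otimes\iota)\Delta=(\iota\otimes\Delta)\Delta$ and both $(\mathcal A\otimes I)\Delta(\mathcal A)$ and $(I\otimes\mathcal A)\Delta(\mathcal A)$ span dense subspaces of $\mathcal A\otimes\mathcal A$; its Haar state $h$ is the state with $(h\otimes\iota)\Delta(a)=h(a)I=(\iota\otimes h)\Delta(a)$. An action of $G$ on a unital C*-algebra $\mathcal C$ is a unital $*$-homomorphism $\delta:\mathcal C\to\mathcal C\otimes\mathcal A$ with $(\delta\otimes\iota)\delta=(\iota\otimes\Delta)\delta$. A compact quantum subgroup of $G$ is a pair $K=(\mathcal A',\Delta')$ of a unital C*-algebra (possibly zero) and a unital $*$-homomorphism $\Delta':\mathcal A'\to\mathcal A'\otimes\mathcal A'$, together with a surjective unital $*$-homomorphism $\pi:\mathcal A\to\mathcal A'$ such that $(\pi\otimes\pi)\Delta=\Delta'\pi$; the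 quantum quotient space $K\backslash G$ is the C*-algebra $\mathcal A^{K}=\{T\in\mathcal A:(\pi\otimes\iota)\Delta(T)=I\otimes T\}$ with the action $\eta':\mathcal A^K\to\mathcal A^K\otimes\mathcal A$ of $G$ obtained by restricting $\Delta$. **Theorem.** Let $\delta:\mathcal C\to\mathcal C\otimes\mathcal A$ be an action of the compact quantum group $G=(\mathcal A,\Delta)$ on a unital C*-algebra $\mathcal C$, and let $\chi:\mathcal C\to\mathbb C$ be a (unital) $*$-character. Assume that (a) the linear span of $(I\otimes\mathcal A)\,\delta(\mathcal C)$ is norm dense in $\mathcal C\otimes\mathcal A$; (b) $\delta$ is ergodic: $\{c\in\mathcal C:\delta(c)=c\otimes I\}=\mathbb C I$; (c) $\delta$ is injective, and the Haar state $h$ of $G$ is faithful, i.e. $h(a^*a)=0$ implies $a=0$. Put $T_\chi=(\chi\otimes\iota)\circ\delta:\mathcal C\to\mathcal A$ and let $J_\chi$ be the closed two-sided ideal of $\mathcal A$ generated by $\{T_\chi(c)-\chi(c)I:c\in\mathcal C\}$. Then there is a compact quantum subgroup $G_\chi$ of $G$ (the subgroup stabilizing $\chi$) whose quotient map $\pi$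 has kernel $J_\chi$. For every such $G_\chi$, the restriction of $\Delta$ defines an action $\eta'$ of $G$ on $\mathcal A^{G_\chi}$, the map $T_\chi$ takes its values in $\mathcal A^{G_\chi}$, it is $G$-equivariant, $\eta'\circ T_\chi=(T_\chi\otimes\iota)\circ\delta$, and $T_\chi:\mathcal C\to\mathcal A^{G_\chi}$ is injective. Thus $\mathcal C$ embeds $G$-equivariantly into the quantum quotient space $G_\chi\backslash G$. -/

import Mathlib

open scoped TensorProduct ComplexOrder InnerProductSpace

universe u

noncomputable section

namespace CQG

/-- A unital `*`-representation of a unital C*-algebra on a Hilbert space. -/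
structure Rep (A : Type u) [CStarAlgebra A] : Type (u + 1) where
  H : Type u
  [ng : NormedAddCommGroup H]
  [ip : InnerProductSpace ℂ H]
  [cs : CompleteSpace H]
  π : A →⋆ₐ[ℂ] (H →L[ℂ] H)

attribute [instance] Rep.ng Rep.ip Rep.cs

/-- The Hilbert space tensor product: the completion of the algebraic tensor product. -/
def HilbertTensor (H K : Type u) [NormedAddCommGroup H] [InnerProductSpace ℂ H]
    [NormedAddCommGroup K] [InnerProductSpace ℂ K] : Type u :=
  UniformSpace.Completion (H ⊗[ℂ] K)

section Hilbert

open UniformSpace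

variable {H K : Type u} [NormedAddCommGroup H] [InnerProductSpace ℂ H]
  [NormedAddCommGroup K] [InnerProductSpace ℂ K]

instance : NormedAddCommGroup (HilbertTensor H K) :=
  inferInstanceAs (NormedAddCommGroup (Completion (H ⊗[ℂ] K)))

instance : InnerProductSpace ℂ (HilbertTensor H K) :=
  inferInstanceAs (InnerProductSpace ℂ (Completion (H ⊗[ℂ] K)))

instance : CompleteSpace (HilbertTensor H K) :=
  inferInstanceAs (CompleteSpace (Completion (H ⊗[ℂ] K)))

/-- The canonical isometric inclusion of the algebraic tensor product. -/
def HilbertTensor.of : (H ⊗[ℂ] K) →ₗᵢ[ℂ] HilbertTensor H K :=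
  Completion.toComplₗᵢ (𝕜 := ℂ) (E := H ⊗[ℂ] K)

theorem HilbertTensor.induction {p : HilbertTensor H K → Prop} (x : HilbertTensor H K)
    (hc : IsClosed {x | p x}) (h : ∀ v : H ⊗[ℂ] K, p (HilbertTensor.of v)) : p x :=
  Completion.induction_on x hc h

/-- The bounded operator `S ⊗ T` on the Hilbert space tensor product. -/
def opTensor (S : H →L[ℂ] H) (T : K →L[ℂ] K) : HilbertTensor H K →L[ℂ] HilbertTensor H K :=
  (TensorProduct.mapL S T).completion

theorem opTensor_of (S : H →L[ℂ] H) (T : K →L[ℂ] K) (v : H ⊗[ℂ] K) :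
    opTensor S T (HilbertTensor.of v) = HilbertTensor.of (TensorProduct.mapL S T v) :=
  ContinuousLinearMap.completion_apply_coe _ _

theorem opTensor_ext {S T : HilbertTensor H K →L[ℂ] HilbertTensor H K}
    (h : ∀ v : H ⊗[ℂ] K, S (HilbertTensor.of v) = T (HilbertTensor.of v)) : S = T := by
  ext x
  exact HilbertTensor.induction x (p := fun x => S x = T x)
    (isClosed_eq S.continuous T.continuous) h

theorem opTensor_mul (S S' : H →L[ℂ] H) (T T' : K →L[ℂ] K) :
    opTensor (S * S') (T * T') = opTensor S T * opTensor S' T' := by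
  apply opTensor_ext
  intro v
  rw [mul_apply_eq_comp, opTensor_of, opTensor_of, opTensor_of, TensorProduct.mapL_mul]
  rfl

theorem opTensor_one : opTensor (1 : H →L[ℂ] H) (1 : K →L[ℂ] K) = 1 := by
  apply opTensor_ext
  intro v
  rw [opTensor_of]
  have : TensorProduct.mapL (1 : H →L[ℂ] H) (1 : K →L[ℂ] K) = ContinuousLinearMap.id ℂ _ :=
    TensorProduct.mapL_id_id
  rw [this]; rfl

theorem inner_mapL [CompleteSpace H] [CompleteSpace K] (S : H →L[ℂ] H) (T : K →L[ℂ] K)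
    (v w : H ⊗[ℂ] K) :
    ⟪TensorProduct.mapL (star S) (star T) v, w⟫_ℂ = ⟪v, TensorProduct.mapL S T w⟫_ℂ := by
  induction v with
  | zero => simp
  | add x y hx hy => rw [map_add, inner_add_left, inner_add_left, hx, hy]
  | tmul x y =>
    induction w with
    | zero => simp
    | add x y hx hy => rw [map_add, inner_add_right, inner_add_right, hx, hy]
    | tmul x' y' =>
      simp [ContinuousLinearMap.star_eq_adjoint, ContinuousLinearMap.adjoint_inner_left]

theorem opTensor_star [CompleteSpace H] [CompleteSpace K] (S : H →L[ℂ] H) (T : K →L[ℂ] K) :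
    opTensor (star S) (star T) = star (opTensor S T) := by
  rw [ContinuousLinearMap.star_eq_adjoint (opTensor S T)]
  refine (ContinuousLinearMap.eq_adjoint_iff _ _).mpr fun x y => ?_
  refine HilbertTensor.induction x
    (p := fun x => ⟪opTensor (star S) (star T) x, y⟫_ℂ = ⟪x, opTensor S T y⟫_ℂ)
    (isClosed_eq (by fun_prop) (by fun_prop)) fun v => ?_
  refine HilbertTensor.induction y
    (p := fun y => ⟪opTensor (star S) (star T) (HilbertTensor.of v), y⟫_ℂ =
      ⟪HilbertTensor.of v, opTensor S T y⟫_ℂ)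
    (isClosed_eq (by fun_prop) (by fun_prop)) fun w => ?_
  rw [opTensor_of, opTensor_of, LinearIsometry.inner_map_map, LinearIsometry.inner_map_map,
    inner_mapL]

theorem norm_opTensor_le (S : H →L[ℂ] H) (T : K →L[ℂ] K) :
    ‖opTensor S T‖ ≤ ‖S‖ * ‖T‖ := by
  refine ContinuousLinearMap.opNorm_le_bound _ (by positivity) fun x => ?_
  refine HilbertTensor.induction x (p := fun x => ‖opTensor S T x‖ ≤ ‖S‖ * ‖T‖ * ‖x‖)
    (isClosed_le (by fun_prop) (by fun_prop)) fun v => ?_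
  rw [opTensor_of, LinearIsometry.norm_map, LinearIsometry.norm_map]
  exact ((TensorProduct.mapL S T).le_opNorm v).trans
    (mul_le_mul_of_nonneg_right (TensorProduct.norm_mapL_le S T) (norm_nonneg _))

theorem opTensor_add_left (S S' : H →L[ℂ] H) (T : K →L[ℂ] K) :
    opTensor (S + S') T = opTensor S T + opTensor S' T := by
  apply opTensor_ext
  intro v
  simp only [add_apply, opTensor_of, TensorProduct.mapL_add_left, map_add]

theorem opTensor_add_right (S : H →L[ℂ] H) (T T' : K →L[ℂ] K) :
    opTensor S (T + T') = opTensor S T + opTensor S T' := by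
  apply opTensor_ext
  intro v
  simp only [add_apply, opTensor_of, TensorProduct.mapL_add_right, map_add]

theorem opTensor_smul_left (c : ℂ) (S : H →L[ℂ] H) (T : K →L[ℂ] K) :
    opTensor (c • S) T = c • opTensor S T := by
  apply opTensor_ext
  intro v
  simp only [smul_apply, opTensor_of, TensorProduct.mapL_smul_left, map_smul]

theorem opTensor_smul_right (c : ℂ) (S : H →L[ℂ] H) (T : K →L[ℂ] K) :
    opTensor S (c • T) = c • opTensor S T := by
  apply opTensor_ext
  intro v
  simp only [smul_apply, opTensor_of, TensorProduct.mapL_smul_right, map_smul]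

end Hilbert

variable {A B : Type u} [CStarAlgebra A] [CStarAlgebra B]

/-- The representation `ρ ⊗ σ` of the algebraic tensor product on the Hilbert space tensor
product, `a ⊗ b ↦ ρ(a) ⊗ σ(b)`. -/
def algRep (ρ : Rep A) (σ : Rep B) :
    A ⊗[ℂ] B →ₐ[ℂ] (HilbertTensor ρ.H σ.H →L[ℂ] HilbertTensor ρ.H σ.H) :=
  Algebra.TensorProduct.algHomOfLinearMapTensorProduct
    (TensorProduct.lift (LinearMap.mk₂ ℂ (fun a b => opTensor (ρ.π a) (σ.π b))
      (fun a a' b => by rw [map_add, opTensor_add_left])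
      (fun c a b => by rw [map_smul, opTensor_smul_left])
      (fun a b b' => by rw [map_add, opTensor_add_right])
      (fun c a b => by rw [map_smul, opTensor_smul_right])))
    (fun a a' b b' => by simp [opTensor_mul])
    (by simp [opTensor_one])

theorem algRep_tmul (ρ : Rep A) (σ : Rep B) (a : A) (b : B) :
    algRep ρ σ (a ⊗ₜ b) = opTensor (ρ.π a) (σ.π b) := rfl

theorem algRep_star (ρ : Rep A) (σ : Rep B) (x : A ⊗[ℂ] B) :
    algRep ρ σ (star x) = star (algRep ρ σ x) := by
  induction x with
  | zero => simp
  | add x y hx hy => simp [hx, hy]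
  | tmul a b => rw [TensorProduct.star_tmul, algRep_tmul, algRep_tmul, map_star, map_star,
      opTensor_star]

theorem Rep.norm_le (ρ : Rep A) (a : A) : ‖ρ.π a‖ ≤ ‖a‖ :=
  NonUnitalStarAlgHom.norm_apply_le ρ.π a

/-- The spatial (minimal) C*-norm on the algebraic tensor product: the supremum of the operator
norms of `(ρ ⊗ σ)(x)` over all pairs of representations. -/
def spatialNorm (x : A ⊗[ℂ] B) : ℝ := ⨆ p : Rep A × Rep B, ‖algRep p.1 p.2 x‖

theorem spatialNorm_bdd (x : A ⊗[ℂ] B) :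
    BddAbove (Set.range fun p : Rep A × Rep B => ‖algRep p.1 p.2 x‖) := by
  induction x with
  | zero => exact ⟨0, by rintro _ ⟨p, rfl⟩; simp⟩
  | add x y hx hy =>
    obtain ⟨M, hM⟩ := hx
    obtain ⟨N, hN⟩ := hy
    refine ⟨M + N, ?_⟩
    rintro _ ⟨p, rfl⟩
    simp only [map_add]
    exact (norm_add_le _ _).trans (add_le_add (hM ⟨p, rfl⟩) (hN ⟨p, rfl⟩))
  | tmul a b =>
    refine ⟨‖a‖ * ‖b‖, ?_⟩
    rintro _ ⟨p, rfl⟩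
    simp only [algRep_tmul]
    exact (norm_opTensor_le _ _).trans
      (mul_le_mul (p.1.norm_le a) (p.2.norm_le b) (norm_nonneg _) (norm_nonneg _))

theorem le_spatialNorm (ρ : Rep A) (σ : Rep B) (x : A ⊗[ℂ] B) :
    ‖algRep ρ σ x‖ ≤ spatialNorm x :=
  le_ciSup (spatialNorm_bdd x) (ρ, σ)

/-- The zero representation space. -/
def Rep.triv (A : Type u) [CStarAlgebra A] : Rep A where
  H := PUnit
  π := { toFun := fun _ => 0, map_one' := Subsingleton.elim _ _, map_mul' := by simp,
         map_zero' := rfl, map_add' := by simp, commutes' := fun _ => Subsingleton.elim _ _,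
         map_star' := by simp }

instance : Nonempty (Rep A × Rep B) := ⟨(Rep.triv A, Rep.triv B)⟩

theorem spatialNorm_le {x : A ⊗[ℂ] B} {M : ℝ}
    (h : ∀ (ρ : Rep A) (σ : Rep B), ‖algRep ρ σ x‖ ≤ M) : spatialNorm x ≤ M :=
  ciSup_le fun p => h p.1 p.2

theorem spatialNorm_nonneg (x : A ⊗[ℂ] B) : 0 ≤ spatialNorm x :=
  (norm_nonneg _).trans (le_spatialNorm (Rep.triv A) (Rep.triv B) x)

/-- The algebraic tensor product, equipped below with the spatial C*-norm. -/
def AlgTensor (A B : Type u) [CStarAlgebra A] [CStarAlgebra B] : Type u := A ⊗[ℂ] B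

namespace AlgTensor

instance : Ring (AlgTensor A B) := inferInstanceAs (Ring (A ⊗[ℂ] B))
instance : Algebra ℂ (AlgTensor A B) := inferInstanceAs (Algebra ℂ (A ⊗[ℂ] B))
instance : StarRing (AlgTensor A B) := inferInstanceAs (StarRing (A ⊗[ℂ] B))
instance : StarModule ℂ (AlgTensor A B) := inferInstanceAs (StarModule ℂ (A ⊗[ℂ] B))

instance : SeminormedRing (AlgTensor A B) :=
  RingSeminorm.toSeminormedRing
    { toFun := fun x => spatialNorm (A := A) (B := B) x
      map_zero' := le_antisymm (spatialNorm_le fun ρ σ => (congrArg norm (map_zero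
          (algRep ρ σ))).trans norm_zero |>.le) (spatialNorm_nonneg _)
      add_le' := fun x y => spatialNorm_le fun ρ σ =>
        (congrArg norm (map_add (algRep ρ σ) x y)).le.trans <| (norm_add_le _ _).trans
          (add_le_add (le_spatialNorm _ _ _) (le_spatialNorm _ _ _))
      neg' := fun x => congrArg iSup (funext fun p =>
        (congrArg norm (map_neg (algRep p.1 p.2) x)).trans (norm_neg _))
      mul_le' := fun x y => spatialNorm_le fun ρ σ =>
        (congrArg norm (map_mul (algRep ρ σ) x y)).le.trans <| (norm_mul_le _ _).trans
          (mul_le_mul (le_spatialNorm _ _ _) (le_spatialNorm _ _ _) (norm_nonneg _)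
            (spatialNorm_nonneg _)) }

theorem norm_def (x : AlgTensor A B) : ‖x‖ = spatialNorm (A := A) (B := B) x := rfl

instance : NormedAlgebra ℂ (AlgTensor A B) where
  norm_smul_le c x := spatialNorm_le fun ρ σ =>
    (congrArg norm (map_smul (algRep ρ σ) c x)).le.trans <| (norm_smul_le _ _).trans
      (mul_le_mul_of_nonneg_left (le_spatialNorm _ _ _) (norm_nonneg _))

theorem norm_star (x : AlgTensor A B) : ‖star x‖ = ‖x‖ :=
  congrArg iSup (funext fun p => (congrArg norm (algRep_star p.1 p.2 x)).trans
    (_root_.norm_star _))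

theorem norm_mul_self_le (x : AlgTensor A B) : ‖x‖ * ‖x‖ ≤ ‖star x * x‖ := by
  have h : ‖x‖ ≤ Real.sqrt ‖star x * x‖ := spatialNorm_le fun ρ σ => by
    apply Real.le_sqrt_of_sq_le
    have h1 : ∀ y : A ⊗[ℂ] B, ‖algRep ρ σ y‖ ^ 2 ≤ spatialNorm (star y * y) := fun y => by
      rw [sq, ← CStarRing.norm_star_mul_self, ← algRep_star, ← map_mul]
      exact le_spatialNorm ρ σ _
    exact h1 x
  calc ‖x‖ * ‖x‖ ≤ Real.sqrt ‖star x * x‖ * Real.sqrt ‖star x * x‖ :=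
        mul_le_mul h h (norm_nonneg _) (Real.sqrt_nonneg _)
    _ = _ := Real.mul_self_sqrt (norm_nonneg _)

end AlgTensor

/-- The spatial tensor product of two unital C*-algebras: the completion of the algebraic tensor
product in the spatial norm. -/
def SpatialTensor (A B : Type u) [CStarAlgebra A] [CStarAlgebra B] : Type u :=
  UniformSpace.Completion (AlgTensor A B)

namespace SpatialTensor

open UniformSpace

instance : NormedRing (SpatialTensor A B) :=
  inferInstanceAs (NormedRing (Completion (AlgTensor A B)))

instance : CompleteSpace (SpatialTensor A B) :=
  inferInstanceAs (CompleteSpace (Completion (AlgTensor A B)))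

instance : Algebra ℂ (SpatialTensor A B) :=
  inferInstanceAs (Algebra ℂ (Completion (AlgTensor A B)))

/-- The canonical map from the algebraic tensor product. -/
def ofAlg (x : AlgTensor A B) : SpatialTensor A B := (x : Completion (AlgTensor A B))

theorem norm_ofAlg (x : AlgTensor A B) : ‖ofAlg x‖ = ‖x‖ := Completion.norm_coe x

theorem ofAlg_add (x y : AlgTensor A B) : ofAlg (x + y) = ofAlg x + ofAlg y :=
  Completion.coe_add x y

theorem ofAlg_mul (x y : AlgTensor A B) : ofAlg (x * y) = ofAlg x * ofAlg y :=
  Completion.coe_mul x y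

theorem ofAlg_one : ofAlg (1 : AlgTensor A B) = 1 := rfl

theorem ofAlg_zero : ofAlg (0 : AlgTensor A B) = 0 := rfl

theorem ofAlg_smul (c : ℂ) (x : AlgTensor A B) : ofAlg (c • x) = c • ofAlg x :=
  Completion.coe_smul c x

@[fun_prop]
theorem continuous_ofAlg : Continuous (ofAlg : AlgTensor A B → SpatialTensor A B) :=
  Completion.continuous_coe _

theorem denseRange_ofAlg : DenseRange (ofAlg : AlgTensor A B → SpatialTensor A B) :=
  Completion.denseRange_coe

theorem isUniformInducing_ofAlg :
    IsUniformInducing (ofAlg : AlgTensor A B → SpatialTensor A B) :=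
  Completion.isUniformInducing_coe _

theorem induction {p : SpatialTensor A B → Prop} (x : SpatialTensor A B)
    (hc : IsClosed {x | p x}) (h : ∀ x : AlgTensor A B, p (ofAlg x)) : p x :=
  Completion.induction_on x hc h

theorem induction₂ {p : SpatialTensor A B → SpatialTensor A B → Prop} (x y : SpatialTensor A B)
    (hc : IsClosed {x : SpatialTensor A B × SpatialTensor A B | p x.1 x.2})
    (h : ∀ x y : AlgTensor A B, p (ofAlg x) (ofAlg y)) : p x y :=
  Completion.induction_on₂ x y hc h

instance : NormedAlgebra ℂ (SpatialTensor A B) where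
  norm_smul_le c x := by
    refine induction x (p := fun x => ‖c • x‖ ≤ ‖c‖ * ‖x‖) (isClosed_le ?_ ?_) fun x => ?_
    · exact (uniformContinuous_const_smul (X := Completion (AlgTensor A B)) c).continuous.norm
    · fun_prop
    · rw [← ofAlg_smul, norm_ofAlg, norm_ofAlg]
      exact norm_smul_le c x

theorem isometry_star_alg : Isometry (star : AlgTensor A B → AlgTensor A B) :=
  AddMonoidHomClass.isometry_of_norm (starAddEquiv (R := AlgTensor A B)) AlgTensor.norm_star

instance : Star (SpatialTensor A B) where
  star := Completion.map (star : AlgTensor A B → AlgTensor A B)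

theorem star_ofAlg (x : AlgTensor A B) : star (ofAlg x) = ofAlg (star x) :=
  Completion.map_coe isometry_star_alg.uniformContinuous x

theorem continuous_star' : Continuous (star : SpatialTensor A B → SpatialTensor A B) :=
  Completion.continuous_map

instance : ContinuousStar (SpatialTensor A B) := ⟨continuous_star'⟩

instance : StarRing (SpatialTensor A B) where
  star_involutive x := by
    refine induction x (p := fun x => star (star x) = x)
      (isClosed_eq (by fun_prop) (by fun_prop)) fun x => ?_
    rw [star_ofAlg, star_ofAlg, star_star]
  star_mul x y := by
    refine induction₂ x y (p := fun x y => star (x * y) = star y * star x)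
      (isClosed_eq (by fun_prop) (by fun_prop)) fun x y => ?_
    simp only [star_ofAlg, ← ofAlg_mul, star_mul]
  star_add x y := by
    refine induction₂ x y (p := fun x y => star (x + y) = star x + star y)
      (isClosed_eq (by fun_prop) (by fun_prop)) fun x y => ?_
    simp only [star_ofAlg, ← ofAlg_add, star_add]

instance : CStarRing (SpatialTensor A B) where
  norm_mul_self_le x := by
    refine induction x (p := fun x => ‖x‖ * ‖x‖ ≤ ‖star x * x‖) (isClosed_le (by fun_prop)
      (by fun_prop)) fun x => ?_
    rw [star_ofAlg, ← ofAlg_mul, norm_ofAlg, norm_ofAlg]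
    exact AlgTensor.norm_mul_self_le x

theorem star_smul' (c : ℂ) (x : SpatialTensor A B) : star (c • x) = star c • star x := by
  have h1 : Continuous fun x : SpatialTensor A B => star (c • x) :=
    continuous_star'.comp (continuous_const_smul c)
  have h2 : Continuous fun x : SpatialTensor A B => star c • star x :=
    (continuous_const_smul (star c)).comp continuous_star'
  refine induction x (p := fun x => star (c • x) = star c • star x)
    (isClosed_eq h1 h2) fun x => ?_
  rw [← ofAlg_smul, star_ofAlg, star_ofAlg, ← ofAlg_smul, star_smul]

instance : StarModule ℂ (SpatialTensor A B) := ⟨star_smul'⟩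

instance : CStarAlgebra (SpatialTensor A B) where

end SpatialTensor
end CQG

namespace CQG

namespace SpatialTensor

open UniformSpace

variable {A B A' B' E : Type u} [CStarAlgebra A] [CStarAlgebra B] [CStarAlgebra A']
  [CStarAlgebra B'] [CStarAlgebra E]

/-- The elementary tensor `a ⊗ b` in the spatial tensor product. -/
def tmul (a : A) (b : B) : SpatialTensor A B :=
  ofAlg (show AlgTensor A B from (a ⊗ₜ[ℂ] b : A ⊗[ℂ] B))

theorem tmul_mul_tmul (a a' : A) (b b' : B) :
    tmul a b * tmul a' b' = tmul (a * a') (b * b') := by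
  rw [tmul, tmul, ← ofAlg_mul]
  exact congrArg ofAlg (Algebra.TensorProduct.tmul_mul_tmul a a' b b')

theorem star_tmul (a : A) (b : B) : star (tmul a b) = tmul (star a) (star b) := by
  rw [tmul, star_ofAlg]
  rfl

theorem one_eq_tmul : (1 : SpatialTensor A B) = tmul 1 1 := rfl

theorem add_tmul (a a' : A) (b : B) : tmul (a + a') b = tmul a b + tmul a' b := by
  rw [tmul, tmul, tmul, ← ofAlg_add]
  exact congrArg ofAlg (TensorProduct.add_tmul a a' b)

theorem tmul_add (a : A) (b b' : B) : tmul a (b + b') = tmul a b + tmul a b' := by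
  rw [tmul, tmul, tmul, ← ofAlg_add]
  exact congrArg ofAlg (TensorProduct.tmul_add a b b')

theorem smul_tmul (c : ℂ) (a : A) (b : B) : tmul (c • a) b = c • tmul a b := by
  rw [tmul, tmul, ← ofAlg_smul]
  exact congrArg ofAlg (TensorProduct.smul_tmul' c a b).symm

theorem tmul_smul (c : ℂ) (a : A) (b : B) : tmul a (c • b) = c • tmul a b := by
  rw [tmul, tmul, ← ofAlg_smul]
  exact congrArg ofAlg (TensorProduct.tmul_smul c a b)

theorem norm_tmul_le (a : A) (b : B) : ‖tmul a b‖ ≤ ‖a‖ * ‖b‖ := by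
  rw [tmul, norm_ofAlg]
  refine spatialNorm_le fun ρ σ => ?_
  rw [algRep_tmul]
  exact (norm_opTensor_le _ _).trans
      (mul_le_mul (ρ.norm_le a) (σ.norm_le b) (norm_nonneg _) (norm_nonneg _))

/-- To prove a closed, additive property it suffices to check elementary tensors. -/
theorem induction_tmul {p : SpatialTensor A B → Prop} (x : SpatialTensor A B)
    (hc : IsClosed {x | p x}) (h0 : p 0) (hadd : ∀ x y, p x → p y → p (x + y))
    (h : ∀ (a : A) (b : B), p (tmul a b)) : p x := by
  refine induction x hc fun y => ?_
  refine TensorProduct.induction_on (motive := fun y : A ⊗[ℂ] B => p (ofAlg y)) y h0 h ?_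
  intro x y hx hy
  exact (congrArg p (ofAlg_add (A := A) (B := B) x y)).mpr (hadd _ _ hx hy)

/-- Extension of a bounded linear map from the algebraic to the spatial tensor product. -/
def extendL {F : Type*} [NormedAddCommGroup F] [NormedSpace ℂ F] [CompleteSpace F]
    (T : A ⊗[ℂ] B →ₗ[ℂ] F) (M : ℝ) (hT : ∀ x, ‖T x‖ ≤ M * spatialNorm x) :
    SpatialTensor A B →L[ℂ] F :=
  (LinearMap.mkContinuous (show AlgTensor A B →ₗ[ℂ] F from T) M hT).fromCompletion

theorem extendL_ofAlg {F : Type*} [NormedAddCommGroup F] [NormedSpace ℂ F] [CompleteSpace F]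
    (T : A ⊗[ℂ] B →ₗ[ℂ] F) (M : ℝ) (hT : ∀ x, ‖T x‖ ≤ M * spatialNorm x) (x : AlgTensor A B) :
    extendL T M hT (ofAlg x) = T x :=
  ContinuousLinearMap.fromCompletion_apply_coe _ _

theorem extendL_tmul {F : Type*} [NormedAddCommGroup F] [NormedSpace ℂ F] [CompleteSpace F]
    (T : A ⊗[ℂ] B →ₗ[ℂ] F) (M : ℝ) (hT : ∀ x, ‖T x‖ ≤ M * spatialNorm x) (a : A) (b : B) :
    extendL T M hT (tmul a b) = T (a ⊗ₜ b) :=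
  extendL_ofAlg T M hT _

/-- Extension of a contractive `*`-homomorphism to the spatial tensor product. -/
def extendHom (T : A ⊗[ℂ] B →ₐ[ℂ] E) (hs : ∀ x, T (star x) = star (T x))
    (hT : ∀ x, ‖T x‖ ≤ spatialNorm x) : SpatialTensor A B →⋆ₐ[ℂ] E :=
  let F := extendL T.toLinearMap 1 (fun x => by rw [one_mul]; exact hT x)
  have hF : ∀ x : AlgTensor A B, F (ofAlg x) = T x := extendL_ofAlg _ _ _
  have h1 : F 1 = 1 := (hF 1).trans (map_one T)
  { toFun := F
    map_one' := h1
    map_mul' := fun x y => by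
      refine induction₂ x y (p := fun x y => F (x * y) = F x * F y)
        (isClosed_eq (by fun_prop) (by fun_prop)) fun x y => ?_
      rw [← ofAlg_mul, hF, hF, hF]
      exact map_mul T _ _
    map_zero' := map_zero F
    map_add' := map_add F
    commutes' := fun r => by
      rw [Algebra.algebraMap_eq_smul_one, Algebra.algebraMap_eq_smul_one, map_smul, h1]
    map_star' := fun x => by
      refine induction x (p := fun x => F (star x) = star (F x))
        (isClosed_eq (by fun_prop) (by fun_prop)) fun x => ?_
      rw [star_ofAlg, hF, hF]
      exact hs x }

theorem extendHom_ofAlg (T : A ⊗[ℂ] B →ₐ[ℂ] E) (hs : ∀ x, T (star x) = star (T x))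
    (hT : ∀ x, ‖T x‖ ≤ spatialNorm x) (x : AlgTensor A B) :
    extendHom T hs hT (ofAlg x) = T x :=
  extendL_ofAlg _ _ _ _

theorem extendHom_tmul (T : A ⊗[ℂ] B →ₐ[ℂ] E) (hs : ∀ x, T (star x) = star (T x))
    (hT : ∀ x, ‖T x‖ ≤ spatialNorm x) (a : A) (b : B) :
    extendHom T hs hT (tmul a b) = T (a ⊗ₜ b) :=
  extendL_ofAlg _ _ _ _

end SpatialTensor

/-- Pulling a representation back along a `*`-homomorphism. -/
def Rep.comp {A A' : Type u} [CStarAlgebra A] [CStarAlgebra A'] (ρ : Rep A') (f : A →⋆ₐ[ℂ] A') :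
    Rep A where
  H := ρ.H
  π := ρ.π.comp f

namespace SpatialTensor

variable {A B A' B' E : Type u} [CStarAlgebra A] [CStarAlgebra B] [CStarAlgebra A']
  [CStarAlgebra B'] [CStarAlgebra E]

/-- The canonical map of the algebraic into the spatial tensor product, as an algebra map. -/
def ofAlgHom (A B : Type u) [CStarAlgebra A] [CStarAlgebra B] :
    A ⊗[ℂ] B →ₐ[ℂ] SpatialTensor A B where
  toFun x := ofAlg x
  map_one' := ofAlg_one
  map_mul' := ofAlg_mul
  map_zero' := ofAlg_zero
  map_add' := ofAlg_add
  commutes' r := by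
    rw [Algebra.algebraMap_eq_smul_one, Algebra.algebraMap_eq_smul_one]
    exact ofAlg_smul r 1

theorem algRep_map (f : A →⋆ₐ[ℂ] A') (g : B →⋆ₐ[ℂ] B') (ρ : Rep A') (σ : Rep B')
    (x : A ⊗[ℂ] B) :
    algRep ρ σ (Algebra.TensorProduct.map f.toAlgHom g.toAlgHom x) =
      algRep (ρ.comp f) (σ.comp g) x := by
  induction x with
  | zero => simp only [map_zero]; rfl
  | add x y hx hy => simp only [map_add, hx, hy]; rfl
  | tmul a b => rfl

/-- The `*`-homomorphism `f ⊗ g` between spatial tensor products. -/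
def map (f : A →⋆ₐ[ℂ] A') (g : B →⋆ₐ[ℂ] B') : SpatialTensor A B →⋆ₐ[ℂ] SpatialTensor A' B' :=
  extendHom ((ofAlgHom A' B').comp (Algebra.TensorProduct.map f.toAlgHom g.toAlgHom))
    (fun x => by
      induction x with
      | zero => simp
      | add x y hx hy => simp only [map_add, star_add, hx, hy]
      | tmul a b =>
        change tmul (f (star a)) (g (star b)) = star (tmul (f a) (g b))
        rw [star_tmul, map_star, map_star])
    (fun x => (norm_ofAlg _).le.trans <| spatialNorm_le fun ρ σ =>
      (congrArg norm (algRep_map f g ρ σ x)).le.trans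
        (le_spatialNorm (ρ.comp f) (σ.comp g) x))

theorem map_tmul (f : A →⋆ₐ[ℂ] A') (g : B →⋆ₐ[ℂ] B') (a : A) (b : B) :
    map f g (tmul a b) = tmul (f a) (g b) :=
  extendHom_tmul _ _ _ a b

/-- The representation `ρ ⊗ σ` of the spatial tensor product. -/
def rep (ρ : Rep A) (σ : Rep B) :
    SpatialTensor A B →⋆ₐ[ℂ] (HilbertTensor ρ.H σ.H →L[ℂ] HilbertTensor ρ.H σ.H) :=
  extendHom (algRep ρ σ) (algRep_star ρ σ) (le_spatialNorm ρ σ)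

theorem rep_tmul (ρ : Rep A) (σ : Rep B) (a : A) (b : B) :
    rep ρ σ (tmul a b) = opTensor (ρ.π a) (σ.π b) :=
  extendHom_tmul _ _ _ a b

/-- The representations `ρ ⊗ σ` separate the points of the spatial tensor product. -/
theorem eq_zero_of_rep (x : SpatialTensor A B) (h : ∀ ρ σ, rep ρ σ x = 0) : x = 0 := by
  rw [← norm_le_zero_iff]
  refine le_of_forall_pos_le_add fun ε hε => ?_
  obtain ⟨y, hy⟩ := denseRange_ofAlg.exists_dist_lt x (half_pos hε)
  rw [dist_eq_norm] at hy
  have h1 : ‖ofAlg y‖ ≤ ε / 2 := by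
    rw [norm_ofAlg]
    refine spatialNorm_le fun ρ σ => ?_
    have : algRep ρ σ y = rep ρ σ (ofAlg y - x) := by
      rw [map_sub, h, sub_zero]
      exact (extendHom_ofAlg _ _ _ y).symm
    rw [this]
    refine (NonUnitalStarAlgHom.norm_apply_le (rep ρ σ) _).trans ?_
    rw [norm_sub_rev]
    exact hy.le
  calc ‖x‖ = ‖(x - ofAlg y) + ofAlg y‖ := by rw [sub_add_cancel]
    _ ≤ ‖x - ofAlg y‖ + ‖ofAlg y‖ := norm_add_le _ _
    _ ≤ 0 + ε := by linarith

end SpatialTensor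

end CQG

namespace CQG

/-- A positive (bounded) linear functional on a C*-algebra. -/
structure PosFunctional (A : Type u) [CStarAlgebra A] extends A →L[ℂ] ℂ where
  nonneg' : ∀ a : A, 0 ≤ toContinuousLinearMap (star a * a)

namespace PosFunctional

variable {A : Type u} [CStarAlgebra A]

instance : CoeFun (PosFunctional A) fun _ => A → ℂ := ⟨fun φ => φ.toContinuousLinearMap⟩

end PosFunctional

section GNS

variable {A : Type u} [CStarAlgebra A]

/-- The vector functional `a ↦ ⟨ξ, ρ(a) ξ⟩` of a representation. -/
def Rep.vec (ρ : Rep A) (ξ : ρ.H) : PosFunctional A where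
  toContinuousLinearMap :=
    LinearMap.mkContinuous
      { toFun := fun a => ⟪ξ, ρ.π a ξ⟫_ℂ
        map_add' := fun a b => by simp
        map_smul' := fun c a => by simp }
      (‖ξ‖ * ‖ξ‖) fun a => by
        refine (norm_inner_le_norm _ _).trans ?_
        have h1 : ‖ρ.π a ξ‖ ≤ ‖a‖ * ‖ξ‖ :=
          ((ρ.π a).le_opNorm ξ).trans (mul_le_mul_of_nonneg_right (ρ.norm_le a) (norm_nonneg _))
        calc ‖ξ‖ * ‖ρ.π a ξ‖ ≤ ‖ξ‖ * (‖a‖ * ‖ξ‖) :=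
              mul_le_mul_of_nonneg_left h1 (norm_nonneg _)
          _ = _ := by ring
  nonneg' a := by
    change 0 ≤ ⟪ξ, ρ.π (star a * a) ξ⟫_ℂ
    rw [map_mul, map_star, mul_apply_eq_comp, ContinuousLinearMap.star_eq_adjoint,
      ContinuousLinearMap.adjoint_inner_right]
    rw [inner_self_eq_norm_sq_to_K, Complex.nonneg_iff]
    constructor
    · have : ((‖ρ.π a ξ‖ : ℂ) ^ 2).re = ‖ρ.π a ξ‖ ^ 2 := by norm_cast
      exact this ▸ sq_nonneg _
    · have : ((‖ρ.π a ξ‖ : ℂ) ^ 2).im = 0 := by norm_cast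
      exact this.symm

theorem Rep.vec_apply (ρ : Rep A) (ξ : ρ.H) (a : A) : ρ.vec ξ a = ⟪ξ, ρ.π a ξ⟫_ℂ := rfl

/-- The GNS construction. -/
theorem PosFunctional.exists_rep (φ : PosFunctional A) :
    ∃ (ρ : Rep A) (ξ : ρ.H), ∀ a, φ a = ⟪ξ, ρ.π a ξ⟫_ℂ := by
  let _ := CStarAlgebra.spectralOrder A
  have _ := CStarAlgebra.spectralOrderedRing A
  have hpos : ∀ a : A, 0 ≤ a → 0 ≤ φ a := fun a ha => by
    obtain ⟨b, rfl⟩ := CStarAlgebra.nonneg_iff_eq_star_mul_self.mp ha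
    exact φ.nonneg' b
  let f : A →ₚ[ℂ] ℂ := PositiveLinearMap.mk₀ φ.toContinuousLinearMap.toLinearMap hpos
  refine ⟨⟨f.GNS, f.gnsStarAlgHom⟩, ((f.toPreGNS 1 : f.PreGNS) : f.GNS), fun a => ?_⟩
  have h1 : f.gnsStarAlgHom a ((f.toPreGNS 1 : f.PreGNS) : f.GNS) =
      ((f.toPreGNS a : f.PreGNS) : f.GNS) := by
    have := f.gnsNonUnitalStarAlgHom_apply_coe (a := a) (b := f.toPreGNS 1)
    refine this.trans ?_
    simp [PositiveLinearMap.leftMulMapPreGNS]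
  change φ a = ⟪((f.toPreGNS 1 : f.PreGNS) : f.GNS),
    f.gnsStarAlgHom a ((f.toPreGNS 1 : f.PreGNS) : f.GNS)⟫_ℂ
  rw [h1, UniformSpace.Completion.inner_coe, PositiveLinearMap.preGNS_inner_def]
  simp
  rfl

/-- A norm-one functional that takes the value one at the unit is positive. -/
theorem nonneg_of_norm_le_one (f : A →L[ℂ] ℂ) (hf : ‖f‖ ≤ 1) (h1 : f 1 = 1) (a : A) :
    0 ≤ f (star a * a) := by
  let _ := CStarAlgebra.spectralOrder A
  have _ := CStarAlgebra.spectralOrderedRing A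
  have him : ∀ c : A, IsSelfAdjoint c → (f c).im = 0 := by
    intro c hc
    by_contra hne
    have key : ∀ t : ℝ, ((f c).im + t) ^ 2 ≤ ‖c‖ ^ 2 + t ^ 2 * ‖(1 : A)‖ := by
      intro t
      have e1 : f (c + (Complex.I * t) • 1) = f c + Complex.I * t := by
        rw [map_add, map_smul, h1, smul_eq_mul, mul_one]
      have e2 : star (c + (Complex.I * t) • (1 : A)) * (c + (Complex.I * t) • 1) =
          c * c + (t ^ 2 : ℂ) • 1 := by
        rw [star_add, hc.star_eq, star_smul, star_one]
        simp only [add_mul, mul_add, smul_mul_assoc, mul_smul_comm, one_mul, mul_one, smul_add,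
          smul_smul]
        have e3 : star (Complex.I * (t : ℂ)) = -(Complex.I * t) := by simp
        rw [e3, neg_smul]
        have e4 : Complex.I * (t : ℂ) * -(Complex.I * t) = t ^ 2 := by
          linear_combination (-(t : ℂ) ^ 2) * Complex.I_mul_I
        rw [e4]
        abel
      have e5 : ‖c + (Complex.I * t) • (1 : A)‖ ^ 2 ≤ ‖c‖ ^ 2 + t ^ 2 * ‖(1 : A)‖ := by
        rw [sq, ← CStarRing.norm_star_mul_self, e2]
        refine (norm_add_le _ _).trans (add_le_add ?_ ?_)
        · rw [sq]; exact norm_mul_le _ _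
        · rw [norm_smul]; simp
      have e6 : ‖f c + Complex.I * t‖ ≤ ‖c + (Complex.I * t) • (1 : A)‖ := by
        rw [← e1]
        refine (f.le_opNorm _).trans ?_
        exact mul_le_of_le_one_left (norm_nonneg _) hf
      have e7 : |(f c).im + t| ≤ ‖f c + Complex.I * t‖ := by
        have := Complex.abs_im_le_norm (f c + Complex.I * t)
        simpa using this
      calc ((f c).im + t) ^ 2 = |(f c).im + t| ^ 2 := (sq_abs _).symm
        _ ≤ ‖c + (Complex.I * t) • (1 : A)‖ ^ 2 := by
          gcongr; exact e7.trans e6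
        _ ≤ _ := e5
    have hn : ‖(1 : A)‖ ≤ 1 := by
      rcases subsingleton_or_nontrivial A with h | h
      · rw [Subsingleton.elim (1 : A) 0]; simp
      · exact CStarRing.norm_one.le
    have h3 := key (((‖c‖ ^ 2 + 1)) / (f c).im)
    have h4 : (((‖c‖ ^ 2 + 1)) / (f c).im) ^ 2 * ‖(1 : A)‖ ≤ (((‖c‖ ^ 2 + 1)) / (f c).im) ^ 2 :=
      mul_le_of_le_one_right (sq_nonneg _) hn
    have h5 : (f c).im * (((‖c‖ ^ 2 + 1)) / (f c).im) = ‖c‖ ^ 2 + 1 := by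
      field_simp
    nlinarith [sq_nonneg (f c).im, sq_nonneg ‖c‖]
  have hsa : IsSelfAdjoint (star a * a) := IsSelfAdjoint.star_mul_self a
  set c := star a * a with hc
  have hc0 : 0 ≤ c := star_mul_self_nonneg a
  have hre : 0 ≤ (f c).re := by
    have h2 : ‖algebraMap ℝ A ‖c‖ - c‖ ≤ ‖c‖ := by
      have hle : c ≤ algebraMap ℝ A ‖c‖ := hsa.le_algebraMap_norm_self
      have h3 : algebraMap ℝ A ‖c‖ - c ≤ algebraMap ℝ A ‖c‖ := sub_le_self _ hc0
      have h4 := CStarAlgebra.norm_le_norm_of_nonneg_of_le (sub_nonneg.mpr hle) h3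
      refine h4.trans ?_
      rw [Algebra.algebraMap_eq_smul_one, norm_smul, norm_norm]
      refine mul_le_of_le_one_right (norm_nonneg _) ?_
      rcases subsingleton_or_nontrivial A with h | h
      · rw [Subsingleton.elim (1 : A) 0]; simp
      · exact CStarRing.norm_one.le
    have h5 : f (algebraMap ℝ A ‖c‖ - c) = ‖c‖ - f c := by
      rw [map_sub, Algebra.algebraMap_eq_smul_one, ← Complex.coe_smul, map_smul, h1, smul_eq_mul,
        mul_one]
    have h6 : ‖(‖c‖ : ℂ) - f c‖ ≤ ‖c‖ := by
      rw [← h5]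
      exact (f.le_opNorm _).trans ((mul_le_of_le_one_left (norm_nonneg _) hf).trans h2)
    have h7 := (Complex.re_le_norm ((‖c‖ : ℂ) - f c)).trans h6
    simp only [Complex.sub_re, Complex.ofReal_re] at h7
    linarith
  rw [Complex.nonneg_iff]
  exact ⟨hre, (him c hsa).symm⟩

/-- There are enough representations. -/
theorem exists_rep_norm (b : A) : ∃ ρ : Rep A, ‖b‖ ≤ ‖ρ.π b‖ := by
  rcases subsingleton_or_nontrivial A with h | h
  · exact ⟨Rep.triv A, by rw [Subsingleton.elim b 0]; simp⟩
  let _ := CStarAlgebra.spectralOrder A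
  have _ := CStarAlgebra.spectralOrderedRing A
  set c := star b * b with hc
  have hc0 : 0 ≤ c := star_mul_self_nonneg b
  have hn : ‖1 + c‖ = 1 + ‖c‖ := by
    apply le_antisymm
    · exact (norm_add_le _ _).trans (by rw [CStarRing.norm_one])
    · have h1 : 1 ≤ ‖1 + c‖ := by
        have := CStarAlgebra.norm_le_norm_of_nonneg_of_le zero_le_one
          (le_add_of_nonneg_right hc0 : (1 : A) ≤ 1 + c)
        rwa [CStarRing.norm_one] at this
      have h2 : ‖c‖ ≤ ‖1 + c‖ - 1 := by
        rw [CStarAlgebra.norm_le_iff_le_algebraMap c (sub_nonneg.mpr h1) hc0, map_sub, map_one,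
          le_sub_iff_add_le, add_comm]
        exact IsSelfAdjoint.le_algebraMap_norm_self
          (IsSelfAdjoint.of_nonneg (add_nonneg zero_le_one hc0))
      linarith
  obtain ⟨f, hf1, hf2⟩ := exists_dual_vector'' ℂ (1 + c)
  rw [hn, map_add] at hf2
  have g1 : ‖f 1‖ ≤ 1 := (f.le_opNorm _).trans (by rw [CStarRing.norm_one, mul_one]; exact hf1)
  have g2 : ‖f c‖ ≤ ‖c‖ := (f.le_opNorm _).trans (mul_le_of_le_one_left (norm_nonneg _) hf1)
  have hre : (f 1).re + (f c).re = 1 + ‖c‖ := by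
    have := congrArg Complex.re hf2
    simpa using this
  have r1 : (f 1).re = 1 := by
    linarith [(Complex.re_le_norm (f 1)), Complex.re_le_norm (f c)]
  have r2 : (f c).re = ‖c‖ := by linarith
  have q1 : f 1 = 1 := by
    have h3 := Complex.sq_norm (f 1)
    rw [Complex.normSq_apply, r1] at h3
    have h4 : (f 1).im = 0 := by nlinarith [norm_nonneg (f 1)]
    exact Complex.ext (by simp [r1]) (by simp [h4])
  let φ : PosFunctional A := ⟨f, nonneg_of_norm_le_one f hf1 q1⟩
  obtain ⟨ρ, ξ, hξ⟩ := φ.exists_rep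
  refine ⟨ρ, ?_⟩
  have n1 : ‖ξ‖ ^ 2 = 1 := by
    have h3 : φ 1 = 1 := q1
    rw [hξ 1, map_one, one_apply_eq_self, inner_self_eq_norm_sq_to_K] at h3
    have h4 : ((‖ξ‖ ^ 2 : ℝ) : ℂ) = (1 : ℝ) := by
      rw [Complex.ofReal_pow, Complex.ofReal_one]; exact h3
    exact Complex.ofReal_injective h4
  have n1' : ‖ξ‖ = 1 := by nlinarith [norm_nonneg ξ]
  have n2 : ‖b‖ ^ 2 = ‖ρ.π b ξ‖ ^ 2 := by
    have h3 : φ c = ⟪ξ, ρ.π c ξ⟫_ℂ := hξ c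
    have h4 : ⟪ξ, ρ.π c ξ⟫_ℂ = ((‖ρ.π b ξ‖ : ℂ)) ^ 2 := by
      rw [hc, map_mul, map_star, mul_apply_eq_comp, ContinuousLinearMap.star_eq_adjoint,
        ContinuousLinearMap.adjoint_inner_right, inner_self_eq_norm_sq_to_K]
      rfl
    have h5 : (φ c).re = ‖c‖ := r2
    rw [h3, h4] at h5
    rw [sq ‖b‖, ← CStarRing.norm_star_mul_self, ← hc, ← h5]
    exact_mod_cast rfl
  have n3 : ‖b‖ = ‖ρ.π b ξ‖ := by
    nlinarith [norm_nonneg b, norm_nonneg (ρ.π b ξ)]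
  rw [n3]
  exact ((ρ.π b).le_opNorm ξ).trans (by rw [n1', mul_one])

end GNS

end CQG

namespace CQG

namespace SpatialTensor

variable {A B C : Type u} [CStarAlgebra A] [CStarAlgebra B] [CStarAlgebra C]

theorem continuous_hom {A : Type*} {B : Type*} [CStarAlgebra A] [CStarAlgebra B]
    (f : A →⋆ₐ[ℂ] B) : Continuous f :=
  AddMonoidHomClass.continuous_of_bound f 1 fun a => by
    rw [one_mul]; exact NonUnitalStarAlgHom.norm_apply_le f a

/-- `a ⊗ b ↦ φ(a) b` on the algebraic tensor product. -/
def algLeftSlice (φ : PosFunctional A) : A ⊗[ℂ] B →ₗ[ℂ] B :=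
  TensorProduct.lift (LinearMap.mk₂ ℂ (fun a b => φ a • b)
    (fun a a' b => by simp [add_smul]) (fun c a b => by simp [mul_smul])
    (fun a b b' => smul_add _ _ _) (fun c a b => smul_comm (φ a) c b))

theorem algLeftSlice_tmul (φ : PosFunctional A) (a : A) (b : B) :
    algLeftSlice φ (a ⊗ₜ b) = φ a • b := rfl

/-- `a ⊗ b ↦ ψ(b) a` on the algebraic tensor product. -/
def algRightSlice (ψ : PosFunctional B) : A ⊗[ℂ] B →ₗ[ℂ] A :=
  TensorProduct.lift (LinearMap.mk₂ ℂ (fun a b => ψ b • a)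
    (fun a a' b => smul_add _ _ _) (fun c a b => smul_comm (ψ b) c a)
    (fun a b b' => by simp [add_smul]) (fun c a b => by simp [mul_smul]))

theorem algRightSlice_tmul (ψ : PosFunctional B) (a : A) (b : B) :
    algRightSlice ψ (a ⊗ₜ b) = ψ b • a := rfl

theorem norm_pi_le_of_inner {ρ : Rep A} {a : A} {N : ℝ} (hN : 0 ≤ N)
    (h : ∀ ζ η : ρ.H, ‖⟪ζ, ρ.π a η⟫_ℂ‖ ≤ N * (‖ζ‖ * ‖η‖)) : ‖ρ.π a‖ ≤ N := by
  refine ContinuousLinearMap.opNorm_le_bound _ hN fun η => ?_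
  have h1 := h (ρ.π a η) η
  rw [inner_self_eq_norm_sq_to_K, norm_pow] at h1
  have h2 : ‖((‖ρ.π a η‖ : ℝ) : ℂ)‖ = ‖ρ.π a η‖ := by simp
  have h3 : ‖ρ.π a η‖ ^ 2 ≤ N * (‖ρ.π a η‖ * ‖η‖) := by
    rw [← h2]; exact h2.symm ▸ h1
  rcases eq_or_lt_of_le (norm_nonneg (ρ.π a η)) with h0 | h0
  · rw [← h0]; positivity
  · nlinarith

theorem inner_algRep_le {ρ : Rep A} {σ : Rep B} (x : A ⊗[ℂ] B) (ξ ξ' : ρ.H) (η η' : σ.H) :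
    ‖⟪HilbertTensor.of (ξ ⊗ₜ[ℂ] η), algRep ρ σ x (HilbertTensor.of (ξ' ⊗ₜ[ℂ] η'))⟫_ℂ‖ ≤
      ‖ξ‖ * ‖η‖ * (spatialNorm x * (‖ξ'‖ * ‖η'‖)) := by
  refine (norm_inner_le_norm _ _).trans ?_
  rw [LinearIsometry.norm_map, TensorProduct.norm_tmul]
  refine mul_le_mul_of_nonneg_left ?_ (by positivity)
  refine ((algRep ρ σ x).le_opNorm _).trans ?_
  rw [LinearIsometry.norm_map, TensorProduct.norm_tmul]
  exact mul_le_mul_of_nonneg_right (le_spatialNorm ρ σ x) (by positivity)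

theorem sq_norm_of_rep {φ : PosFunctional A} {ρ : Rep A} {ξ : ρ.H}
    (h : ∀ a, φ a = ⟪ξ, ρ.π a ξ⟫_ℂ) : (φ 1).re = ‖ξ‖ * ‖ξ‖ := by
  rw [h 1, map_one, one_apply_eq_self, ← sq]
  exact inner_self_eq_norm_sq (𝕜 := ℂ) ξ

theorem norm_algLeftSlice_le (φ : PosFunctional A) (x : A ⊗[ℂ] B) :
    ‖algLeftSlice φ x‖ ≤ (φ 1).re * spatialNorm x := by
  obtain ⟨ρ, ξ, hξ⟩ := φ.exists_rep
  obtain ⟨σ, hσ⟩ := exists_rep_norm (algLeftSlice φ x)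
  rw [sq_norm_of_rep hξ]
  refine hσ.trans (norm_pi_le_of_inner (mul_nonneg (by positivity) (spatialNorm_nonneg x)) ?_)
  intro ζ η
  have key : ∀ y : A ⊗[ℂ] B, ⟪ζ, σ.π (algLeftSlice φ y) η⟫_ℂ =
      ⟪HilbertTensor.of (ξ ⊗ₜ[ℂ] ζ), algRep ρ σ y (HilbertTensor.of (ξ ⊗ₜ[ℂ] η))⟫_ℂ := by
    intro y
    induction y with
    | zero => simp
    | add y z hy hz => simp only [map_add, add_apply, inner_add_right, hy, hz]
    | tmul a b =>
      rw [algLeftSlice_tmul, algRep_tmul, opTensor_of, LinearIsometry.inner_map_map,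
        TensorProduct.mapL_tmul, TensorProduct.inner_tmul, map_smul, smul_apply, inner_smul_right,
        hξ]
  rw [key]
  refine (inner_algRep_le x ξ ξ ζ η).trans (le_of_eq ?_)
  ring

theorem norm_algRightSlice_le (ψ : PosFunctional B) (x : A ⊗[ℂ] B) :
    ‖algRightSlice ψ x‖ ≤ (ψ 1).re * spatialNorm x := by
  obtain ⟨σ, η, hη⟩ := ψ.exists_rep
  obtain ⟨ρ, hρ⟩ := exists_rep_norm (algRightSlice ψ x)
  rw [sq_norm_of_rep hη]
  refine hρ.trans (norm_pi_le_of_inner (mul_nonneg (by positivity) (spatialNorm_nonneg x)) ?_)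
  intro ζ ξ
  have key : ∀ y : A ⊗[ℂ] B, ⟪ζ, ρ.π (algRightSlice ψ y) ξ⟫_ℂ =
      ⟪HilbertTensor.of (ζ ⊗ₜ[ℂ] η), algRep ρ σ y (HilbertTensor.of (ξ ⊗ₜ[ℂ] η))⟫_ℂ := by
    intro y
    induction y with
    | zero => simp
    | add y z hy hz => simp only [map_add, add_apply, inner_add_right, hy, hz]
    | tmul a b =>
      rw [algRightSlice_tmul, algRep_tmul, opTensor_of, LinearIsometry.inner_map_map,
        TensorProduct.mapL_tmul, TensorProduct.inner_tmul, map_smul, smul_apply, inner_smul_right,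
        hη, mul_comm]
  rw [key]
  refine (inner_algRep_le x ζ ξ η η).trans (le_of_eq ?_)
  ring

/-- The slice map `φ ⊗ ι : A ⊗ B → B`. -/
def leftSlice (φ : PosFunctional A) : SpatialTensor A B →L[ℂ] B :=
  extendL (algLeftSlice φ) _ (norm_algLeftSlice_le φ)

/-- The slice map `ι ⊗ ψ : A ⊗ B → A`. -/
def rightSlice (ψ : PosFunctional B) : SpatialTensor A B →L[ℂ] A :=
  extendL (algRightSlice ψ) _ (norm_algRightSlice_le ψ)

theorem leftSlice_tmul (φ : PosFunctional A) (a : A) (b : B) :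
    leftSlice φ (tmul a b) = φ a • b := extendL_tmul _ _ _ a b

theorem rightSlice_tmul (ψ : PosFunctional B) (a : A) (b : B) :
    rightSlice ψ (tmul a b) = ψ b • a := extendL_tmul _ _ _ a b

theorem sesq_eq_zero {V : Type*} [AddCommGroup V] [Module ℂ V] (s : V → V → ℂ)
    (hl : ∀ x y z, s (x + y) z = s x z + s y z) (hr : ∀ x y z, s x (y + z) = s x y + s x z)
    (hls : ∀ (c : ℂ) x y, s (c • x) y = star c * s x y) (hrs : ∀ (c : ℂ) x y, s x (c • y) = c * s x y)
    (h0 : ∀ x, s x x = 0) (x y : V) : s x y = 0 := by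
  have h1 := h0 (x + y)
  have h2 := h0 (x + Complex.I • y)
  simp only [hl, hr, hls, hrs, h0] at h1 h2
  simp only [Complex.star_def, Complex.conj_I] at h2
  have h3 : Complex.I * s x y - Complex.I * s y x = 0 := by linear_combination h2
  have h4 : Complex.I * (2 * s x y) = 0 := by linear_combination h3 + Complex.I * h1
  simpa using h4

theorem op_eq_zero {H K : Type u} [NormedAddCommGroup H] [InnerProductSpace ℂ H]
    [NormedAddCommGroup K] [InnerProductSpace ℂ K]
    (T : HilbertTensor H K →L[ℂ] HilbertTensor H K)
    (h : ∀ (ξ : H) (η : K), ⟪HilbertTensor.of (ξ ⊗ₜ[ℂ] η), T (HilbertTensor.of (ξ ⊗ₜ[ℂ] η))⟫_ℂ = 0) :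
    T = 0 := by
  have h1 : ∀ (ξ ξ' : H) (η : K),
      ⟪HilbertTensor.of (ξ ⊗ₜ[ℂ] η), T (HilbertTensor.of (ξ' ⊗ₜ[ℂ] η))⟫_ℂ = 0 := fun ξ ξ' η =>
    sesq_eq_zero (fun ξ ξ' : H =>
        ⟪HilbertTensor.of (ξ ⊗ₜ[ℂ] η), T (HilbertTensor.of (ξ' ⊗ₜ[ℂ] η))⟫_ℂ)
      (fun x y z => by simp only [TensorProduct.add_tmul, map_add, inner_add_left])
      (fun x y z => by simp only [TensorProduct.add_tmul, map_add, inner_add_right])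
      (fun c x y => by
        simp only [← TensorProduct.smul_tmul', map_smul, inner_smul_left]; rfl)
      (fun c x y => by simp only [← TensorProduct.smul_tmul', map_smul, inner_smul_right])
      (fun x => h x η) ξ ξ'
  have h2 : ∀ (ξ ξ' : H) (η η' : K),
      ⟪HilbertTensor.of (ξ ⊗ₜ[ℂ] η), T (HilbertTensor.of (ξ' ⊗ₜ[ℂ] η'))⟫_ℂ = 0 :=
    fun ξ ξ' η η' =>
    sesq_eq_zero (fun η η' : K =>
        ⟪HilbertTensor.of (ξ ⊗ₜ[ℂ] η), T (HilbertTensor.of (ξ' ⊗ₜ[ℂ] η'))⟫_ℂ)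
      (fun x y z => by simp only [TensorProduct.tmul_add, map_add, inner_add_left])
      (fun x y z => by simp only [TensorProduct.tmul_add, map_add, inner_add_right])
      (fun c x y => by
        simp only [TensorProduct.tmul_smul, map_smul, inner_smul_left]; rfl)
      (fun c x y => by simp only [TensorProduct.tmul_smul, map_smul, inner_smul_right])
      (fun x => h1 ξ ξ' x) η η'
  apply opTensor_ext
  intro w
  rw [zero_apply]
  have h3 : ∀ v : H ⊗[ℂ] K, ⟪HilbertTensor.of v, T (HilbertTensor.of w)⟫_ℂ = 0 := by
    intro v
    induction v with
    | zero => simp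
    | add x y hx hy => rw [map_add, inner_add_left, hx, hy, add_zero]
    | tmul ξ η =>
      induction w with
      | zero => simp
      | add x y hx hy => rw [map_add, map_add, inner_add_right, hx, hy, add_zero]
      | tmul ξ' η' => exact h2 ξ ξ' η η'
  have h4 : ∀ z, ⟪z, T (HilbertTensor.of w)⟫_ℂ = 0 := fun z =>
    HilbertTensor.induction z (p := fun z => ⟪z, T (HilbertTensor.of w)⟫_ℂ = 0)
      (isClosed_eq (by fun_prop) (by fun_prop)) h3
  exact inner_self_eq_zero.mp (h4 _)

/-- Slices by positive functionals separate points. -/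
theorem eq_zero_of_slices (x : SpatialTensor A B)
    (h : ∀ (φ : PosFunctional A) (ψ : PosFunctional B), ψ (leftSlice φ x) = 0) : x = 0 := by
  refine eq_zero_of_rep x fun ρ σ => op_eq_zero _ fun ξ η => ?_
  rw [← h (ρ.vec ξ) (σ.vec η)]
  refine induction_tmul x (p := fun x =>
    ⟪HilbertTensor.of (ξ ⊗ₜ[ℂ] η), rep ρ σ x (HilbertTensor.of (ξ ⊗ₜ[ℂ] η))⟫_ℂ =
      σ.vec η (leftSlice (ρ.vec ξ) x)) ?_ ?_ ?_ ?_
  · refine isClosed_eq ?_ (by fun_prop)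
    have : Continuous (rep ρ σ) := continuous_hom (rep ρ σ)
    fun_prop
  · simp
  · intro x y hx hy
    simp only [map_add, add_apply, inner_add_right, hx, hy]
  · intro a b
    rw [rep_tmul, leftSlice_tmul, opTensor_of, LinearIsometry.inner_map_map,
      TensorProduct.mapL_tmul, TensorProduct.inner_tmul, map_smul, smul_eq_mul, Rep.vec_apply,
      Rep.vec_apply]

end SpatialTensor

end CQG

namespace CQG

namespace SpatialTensor

section Assoc

variable (A B C : Type u) [CStarAlgebra A] [CStarAlgebra B] [CStarAlgebra C]

instance prodCStarAlgebra {M N : Type u} [CStarAlgebra M] [CStarAlgebra N] :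
    CStarAlgebra (M × N) where

/-- The pairs `(a ⊗ (b ⊗ c), (a ⊗ b) ⊗ c)`. -/
def assocGen : Set (SpatialTensor A (SpatialTensor B C) × SpatialTensor (SpatialTensor A B) C) :=
  {p | ∃ (a : A) (b : B) (c : C), p = (tmul a (tmul b c), tmul (tmul a b) c)}

/-- The graph of the associativity isomorphism: the closed `*`-algebra generated by the pairs
`(a ⊗ (b ⊗ c), (a ⊗ b) ⊗ c)`. -/
def assocGraph : StarSubalgebra ℂ
    (SpatialTensor A (SpatialTensor B C) × SpatialTensor (SpatialTensor A B) C) :=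
  (StarAlgebra.adjoin ℂ (assocGen A B C)).topologicalClosure

instance : IsClosed (assocGraph A B C : Set
    (SpatialTensor A (SpatialTensor B C) × SpatialTensor (SpatialTensor A B) C)) :=
  StarSubalgebra.isClosed_topologicalClosure _

variable {A B C}

theorem mem_assocGraph (a : A) (b : B) (c : C) :
    ((tmul a (tmul b c), tmul (tmul a b) c) :
      SpatialTensor A (SpatialTensor B C) × SpatialTensor (SpatialTensor A B) C) ∈
      assocGraph A B C :=
  StarSubalgebra.le_topologicalClosure _ (StarAlgebra.subset_adjoin ℂ _ ⟨a, b, c, rfl⟩)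

theorem adjoin_assocGen_le
    (x : SpatialTensor A (SpatialTensor B C) × SpatialTensor (SpatialTensor A B) C)
    (hx : x ∈ StarAlgebra.adjoin ℂ (assocGen A B C)) :
    x ∈ Submodule.span ℂ (assocGen A B C) := by
  have hmul : ∀ x ∈ Submodule.span ℂ (assocGen A B C), ∀ y ∈ Submodule.span ℂ (assocGen A B C),
      x * y ∈ Submodule.span ℂ (assocGen A B C) := by
    intro x hx y hy
    induction hx using Submodule.span_induction with
    | zero => rw [zero_mul]; exact zero_mem _
    | add x x' _ _ h1 h2 => rw [add_mul]; exact add_mem h1 h2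
    | smul c x _ h1 => rw [smul_mul_assoc]; exact Submodule.smul_mem _ _ h1
    | mem x hx =>
      induction hy using Submodule.span_induction with
      | zero => rw [mul_zero]; exact zero_mem _
      | add x x' _ _ h1 h2 => rw [mul_add]; exact add_mem h1 h2
      | smul c x _ h1 => rw [mul_smul_comm]; exact Submodule.smul_mem _ _ h1
      | mem y hy =>
        obtain ⟨a, b, c, rfl⟩ := hx
        obtain ⟨a', b', c', rfl⟩ := hy
        refine Submodule.subset_span ⟨a * a', b * b', c * c', ?_⟩
        simp only [Prod.mk_mul_mk, tmul_mul_tmul]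
  induction hx using StarAlgebra.adjoin_induction with
  | mem x h => exact Submodule.subset_span h
  | algebraMap r =>
    rw [Algebra.algebraMap_eq_smul_one]
    exact Submodule.smul_mem _ _ (Submodule.subset_span ⟨1, 1, 1, rfl⟩)
  | add x y _ _ h1 h2 => exact add_mem h1 h2
  | mul x y _ _ h1 h2 => exact hmul x h1 y h2
  | star x hx0 h1 =>
    clear hx0
    induction h1 using Submodule.span_induction with
    | zero => rw [star_zero]; exact zero_mem _
    | add x x' _ _ h1 h2 => rw [star_add]; exact add_mem h1 h2
    | smul c x _ h1 => rw [star_smul]; exact Submodule.smul_mem _ _ h1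
    | mem x hx =>
      obtain ⟨a, b, c, rfl⟩ := hx
      refine Submodule.subset_span ⟨star a, star b, star c, ?_⟩
      rw [Prod.star_def]
      simp only [star_tmul]

theorem assocGraph_slices (φ : PosFunctional A) (ψ : PosFunctional B) (ω : PosFunctional C)
    (p : SpatialTensor A (SpatialTensor B C) × SpatialTensor (SpatialTensor A B) C)
    (hp : p ∈ assocGraph A B C) :
    ω (leftSlice ψ (leftSlice φ p.1)) = ψ (leftSlice φ (rightSlice ω p.2)) := by
  have hcl : IsClosed {p : SpatialTensor A (SpatialTensor B C) × SpatialTensor (SpatialTensor A B) C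
      | ω (leftSlice ψ (leftSlice φ p.1)) = ψ (leftSlice φ (rightSlice ω p.2))} :=
    isClosed_eq (by fun_prop) (by fun_prop)
  refine closure_minimal ?_ hcl hp
  intro q hq
  have hq' := adjoin_assocGen_le q hq
  clear hq
  induction hq' using Submodule.span_induction with
  | zero => simp
  | add x y _ _ h1 h2 =>
    simp only [Set.mem_ofPred_eq] at h1 h2 ⊢
    simp only [Prod.fst_add, Prod.snd_add, map_add, h1, h2]
  | smul c x _ h1 =>
    simp only [Set.mem_ofPred_eq] at h1 ⊢
    simp only [Prod.smul_fst, Prod.smul_snd, map_smul, h1]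
  | mem x hx =>
    obtain ⟨a, b, c, rfl⟩ := hx
    simp only [Set.mem_ofPred_eq, leftSlice_tmul, rightSlice_tmul, map_smul, smul_eq_mul]
    ring

/-- The projection of the graph to the second factor. -/
def assocSnd : assocGraph A B C →⋆ₐ[ℂ] SpatialTensor (SpatialTensor A B) C :=
  (StarAlgHom.snd ℂ _ _).comp (assocGraph A B C).subtype

/-- The projection of the graph to the first factor. -/
def assocFst : assocGraph A B C →⋆ₐ[ℂ] SpatialTensor A (SpatialTensor B C) :=
  (StarAlgHom.fst ℂ _ _).comp (assocGraph A B C).subtype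

theorem assocSnd_injective : Function.Injective (assocSnd (A := A) (B := B) (C := C)) := by
  rw [injective_iff_map_eq_zero]
  rintro ⟨⟨m, n⟩, hp⟩ h0
  have hn : n = 0 := h0
  subst hn
  have hm : m = 0 := by
    refine eq_zero_of_slices m fun φ θ => ?_
    have : leftSlice φ m = 0 := by
      refine eq_zero_of_slices _ fun ψ ω => ?_
      rw [assocGraph_slices φ ψ ω _ hp]
      simp
    rw [this, map_zero]
  subst hm
  rfl

theorem assocSnd_surjective : Function.Surjective (assocSnd (A := A) (B := B) (C := C)) := by
  have hiso : Isometry (assocSnd (A := A) (B := B) (C := C)) :=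
    NonUnitalStarAlgHom.isometry _ assocSnd_injective
  have hcl : IsClosed (Set.range (assocSnd (A := A) (B := B) (C := C))) :=
    hiso.isClosedEmbedding.isClosed_range
  intro n
  refine induction_tmul n (p := fun n => n ∈ Set.range (assocSnd (A := A) (B := B) (C := C)))
    hcl ⟨0, map_zero _⟩ ?_ ?_
  · rintro _ _ ⟨x, rfl⟩ ⟨y, rfl⟩
    exact ⟨x + y, map_add _ _ _⟩
  · intro d c
    refine induction_tmul d (p := fun d => tmul d c ∈
      Set.range (assocSnd (A := A) (B := B) (C := C))) ?_ ?_ ?_ ?_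
    · refine hcl.preimage (f := fun d => tmul d c) ?_
      exact AddMonoidHomClass.continuous_of_bound
        (AddMonoidHom.mk' (fun d : SpatialTensor A B => tmul d c) fun x y => add_tmul x y c) ‖c‖
        fun d => (norm_tmul_le d c).trans (mul_comm _ _).le
    · exact ⟨0, by rw [map_zero, ← zero_smul ℂ (0 : SpatialTensor A B), smul_tmul, zero_smul]⟩
    · rintro x y ⟨u, hu⟩ ⟨v, hv⟩
      exact ⟨u + v, by rw [map_add, hu, hv, add_tmul]⟩
    · intro a b
      exact ⟨⟨_, mem_assocGraph a b c⟩, rfl⟩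

/-- The inverse of the projection of the graph to the second factor. -/
def assocEquiv : assocGraph A B C ≃⋆ₐ[ℂ] SpatialTensor (SpatialTensor A B) C :=
  StarAlgEquiv.ofBijective assocSnd ⟨assocSnd_injective, assocSnd_surjective⟩

/-- The associativity isomorphism `(A ⊗ B) ⊗ C → A ⊗ (B ⊗ C)`, `(a ⊗ b) ⊗ c ↦ a ⊗ (b ⊗ c)`. -/
def assoc : SpatialTensor (SpatialTensor A B) C →⋆ₐ[ℂ] SpatialTensor A (SpatialTensor B C) :=
  assocFst.comp (StarAlgHomClass.toStarAlgHom (assocEquiv (A := A) (B := B) (C := C)).symm)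

theorem assoc_tmul (a : A) (b : B) (c : C) :
    assoc (tmul (tmul a b) c) = tmul a (tmul b c) := by
  have h : assocEquiv.symm (tmul (tmul a b) c) = ⟨_, mem_assocGraph a b c⟩ := by
    rw [StarAlgEquiv.symm_apply_eq]
    rfl
  exact congrArg assocFst h

end Assoc

end SpatialTensor

end CQG

namespace CQG

open SpatialTensor

section Defs

variable {A C : Type u} [CStarAlgebra A] [CStarAlgebra C]

/-- The `*`-homomorphism `b ↦ 1 ⊗ b`. -/
def SpatialTensor.inclRight (A B : Type u) [CStarAlgebra A] [CStarAlgebra B] :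
    B →⋆ₐ[ℂ] SpatialTensor A B where
  toFun b := tmul 1 b
  map_one' := one_eq_tmul.symm
  map_mul' a b := by rw [tmul_mul_tmul, one_mul]
  map_zero' := by rw [← zero_smul ℂ (0 : B), tmul_smul, zero_smul]
  map_add' := tmul_add 1
  commutes' r := by
    rw [Algebra.algebraMap_eq_smul_one, Algebra.algebraMap_eq_smul_one, tmul_smul, one_eq_tmul]
  map_star' b := by rw [star_tmul, star_one]

/-- A `*`-character, viewed as a positive functional. -/
def charFunctional (χ : C →⋆ₐ[ℂ] ℂ) : PosFunctional C where
  toContinuousLinearMap := ⟨χ.toAlgHom.toLinearMap, continuous_hom χ⟩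
  nonneg' a := by
    change 0 ≤ χ (star a * a)
    rw [map_mul, map_star]
    exact star_mul_self_nonneg _

/-- The slice map `χ ⊗ ι : C ⊗ A → A` by a `*`-character, a `*`-homomorphism. -/
def charSlice (χ : C →⋆ₐ[ℂ] ℂ) : SpatialTensor C A →⋆ₐ[ℂ] A :=
  have h : ∀ x y : SpatialTensor C A, leftSlice (charFunctional χ) (x * y) =
      leftSlice (charFunctional χ) x * leftSlice (charFunctional χ) y := by
    intro x y
    refine induction_tmul x (p := fun x => leftSlice (charFunctional χ) (x * y) =
      leftSlice (charFunctional χ) x * leftSlice (charFunctional χ) y)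
      (isClosed_eq (by fun_prop) (by fun_prop)) (by simp)
      (fun x x' h h' => by rw [add_mul, map_add, map_add, add_mul, h, h']) fun c a => ?_
    refine induction_tmul y (p := fun y => leftSlice (charFunctional χ) (tmul c a * y) =
      leftSlice (charFunctional χ) (tmul c a) * leftSlice (charFunctional χ) y)
      (isClosed_eq (by fun_prop) (by fun_prop)) (by simp)
      (fun x x' h h' => by rw [mul_add, map_add, map_add, mul_add, h, h']) fun c' a' => ?_
    have e : charFunctional χ (c * c') = charFunctional χ c * charFunctional χ c' :=
      map_mul χ c c'
    rw [tmul_mul_tmul, leftSlice_tmul, leftSlice_tmul, leftSlice_tmul, e, smul_mul_smul_comm]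
  have h1 : leftSlice (charFunctional χ) (1 : SpatialTensor C A) = 1 := by
    have e : charFunctional χ 1 = 1 := map_one χ
    rw [one_eq_tmul, leftSlice_tmul, e, one_smul]
  { toFun := leftSlice (charFunctional χ)
    map_one' := h1
    map_mul' := h
    map_zero' := map_zero _
    map_add' := map_add _
    commutes' := fun r => by
      rw [Algebra.algebraMap_eq_smul_one, Algebra.algebraMap_eq_smul_one, map_smul, h1]
    map_star' := fun x => by
      refine induction_tmul x (p := fun x => leftSlice (charFunctional χ) (star x) =
        star (leftSlice (charFunctional χ) x)) (isClosed_eq (by fun_prop) (by fun_prop)) (by simp)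
        (fun x x' h h' => by rw [star_add, map_add, map_add, star_add, h, h']) fun c a => ?_
      have e : charFunctional χ (star c) = star (charFunctional χ c) := map_star χ c
      rw [star_tmul, leftSlice_tmul, leftSlice_tmul, e, star_smul] }

theorem charSlice_tmul (χ : C →⋆ₐ[ℂ] ℂ) (c : C) (a : A) :
    charSlice χ (tmul c a) = χ c • a := leftSlice_tmul _ c a

end Defs

/-- A compact quantum group structure on a unital C*-algebra `A`, in the sense of Woronowicz. -/
structure CompactQuantumGroup (A : Type u) [CStarAlgebra A] where
  /-- the coproduct -/
  Δ : A →⋆ₐ[ℂ] SpatialTensor A A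
  coassoc : ∀ a, assoc (map Δ (StarAlgHom.id ℂ A) (Δ a)) = map (StarAlgHom.id ℂ A) Δ (Δ a)
  dense_left : Dense (Submodule.span ℂ
    {x | ∃ b c : A, x = tmul b 1 * Δ c} : Set (SpatialTensor A A))
  dense_right : Dense (Submodule.span ℂ
    {x | ∃ b c : A, x = tmul 1 b * Δ c} : Set (SpatialTensor A A))

/-- A positive functional is faithful if it vanishes on no nonzero positive element. -/
def PosFunctional.IsFaithful {A : Type u} [CStarAlgebra A] (φ : PosFunctional A) : Prop :=
  ∀ a : A, φ (star a * a) = 0 → a = 0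

/-- The Haar state: the invariant state `h`, `(h ⊗ ι)Δ(a) = h(a)1 = (ι ⊗ h)Δ(a)`. -/
structure CompactQuantumGroup.IsHaarState {A : Type u} [CStarAlgebra A]
    (G : CompactQuantumGroup A) (h : PosFunctional A) : Prop where
  map_one : h 1 = 1
  left_inv : ∀ a, leftSlice h (G.Δ a) = h a • (1 : A)
  right_inv : ∀ a, rightSlice h (G.Δ a) = h a • (1 : A)

/-- An action of a compact quantum group on a unital C*-algebra `C`. -/
structure Action {A : Type u} [CStarAlgebra A] (G : CompactQuantumGroup A) (C : Type u)
    [CStarAlgebra C] where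
  δ : C →⋆ₐ[ℂ] SpatialTensor C A
  coassoc : ∀ c, assoc (map δ (StarAlgHom.id ℂ A) (δ c)) = map (StarAlgHom.id ℂ C) G.Δ (δ c)

namespace Action

variable {A C : Type u} [CStarAlgebra A] [CStarAlgebra C] {G : CompactQuantumGroup A}

/-- `(1 ⊗ A) δ(C)` spans a dense subspace of `C ⊗ A`. -/
def IsNondegenerate (α : Action G C) : Prop :=
  Dense (Submodule.span ℂ {x | ∃ (a : A) (c : C), x = tmul 1 a * α.δ c} :
    Set (SpatialTensor C A))

/-- The fixed point algebra consists of the scalars only. -/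
def IsErgodic (α : Action G C) : Prop :=
  ∀ c : C, α.δ c = tmul c 1 → ∃ z : ℂ, c = z • (1 : C)

/-- The map `T_χ = (χ ⊗ ι) ∘ δ : C → A`. -/
def orbitMap (α : Action G C) (χ : C →⋆ₐ[ℂ] ℂ) : C →⋆ₐ[ℂ] A := (charSlice χ).comp α.δ

/-- The closed two-sided ideal generated by the elements `T_χ(c) - χ(c) 1`. -/
def stabilizerIdeal (α : Action G C) (χ : C →⋆ₐ[ℂ] ℂ) : Set A :=
  closure (TwoSidedIdeal.span {a : A | ∃ c : C, a = α.orbitMap χ c - χ c • (1 : A)} : Set A)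

end Action

/-- A compact quantum subgroup of `G = (A, Δ)`: a unital C*-algebra `A'` with a unital
`*`-homomorphism `Δ' : A' → A' ⊗ A'` and a unital `*`-epimorphism `π : A → A'` such that
`(π ⊗ π) Δ = Δ' π`. -/
structure QuantumSubgroup {A : Type u} [CStarAlgebra A] (G : CompactQuantumGroup A) :
    Type (u + 1) where
  carrier : Type u
  [cstar : CStarAlgebra carrier]
  Δ' : carrier →⋆ₐ[ℂ] SpatialTensor carrier carrier
  π : A →⋆ₐ[ℂ] carrier
  surjective : Function.Surjective π
  compat : ∀ a, map π π (G.Δ a) = Δ' (π a)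

attribute [instance] QuantumSubgroup.cstar

namespace QuantumSubgroup

variable {A C : Type u} [CStarAlgebra A] [CStarAlgebra C] {G : CompactQuantumGroup A}

/-- The quantum right coset space `{T ∈ A : (π ⊗ ι)Δ(T) = 1 ⊗ T}`, the algebra of `K \ G`. -/
def rightCoset (K : QuantumSubgroup G) : StarSubalgebra ℂ A :=
  StarAlgHom.equalizer ((map K.π (StarAlgHom.id ℂ A)).comp G.Δ) (inclRight K.carrier A)

theorem mem_rightCoset (K : QuantumSubgroup G) (a : A) :
    a ∈ K.rightCoset ↔ map K.π (StarAlgHom.id ℂ A) (G.Δ a) = tmul 1 a := Iff.rfl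

instance (K : QuantumSubgroup G) : IsClosed (K.rightCoset : Set A) :=
  isClosed_eq (continuous_hom _) (continuous_hom _)

/-- The action of `G` on the quantum right coset space that is the restriction of the coproduct:
`η : A^K → A^K ⊗ A` becomes `Δ` after the inclusion `A^K ⊗ A → A ⊗ A`. -/
def IsQuotientAction (K : QuantumSubgroup G) (η : Action G K.rightCoset) : Prop :=
  ∀ x : K.rightCoset,
    map K.rightCoset.subtype (StarAlgHom.id ℂ A) (η.δ x) = G.Δ (x : A)

/-- `K` is the subgroup stabilizing the character `χ`: the kernel of `π : A → A'` is the closed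
two-sided ideal generated by the elements `T_χ(c) - χ(c) 1`; that is, `A' = A / J_χ`. -/
def IsStabilizer (K : QuantumSubgroup G) (α : Action G C) (χ : C →⋆ₐ[ℂ] ℂ) : Prop :=
  ∀ a : A, K.π a = 0 ↔ a ∈ α.stabilizerIdeal χ

end QuantumSubgroup

end CQG
end

/-! Write `E_φ = (φ ⊗ ι)Δ` for a functional `φ`. Three facts carry the theorem.

The subgroup exists because `Δ` descends to `A/J_χ`. Coassociativity of `δ` gives `Δ T_χ = (T_χ ⊗
ι)δ` (`comul_orbitMap`). If `π T_χ = χ(·)1`, this yields `(π ⊗ σ)Δ T_χ = 1 ⊗ σ T_χ` for every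
`*`-homomorphism `σ` (`map_comul_orbitMap`). With `σ = π` it shows that `(π ⊗ π)Δ` kills the
generators of `J_χ`; with `σ = ι` it says that `T_χ` takes its values in `A^K`. The quotient is a
C*-algebra by the usual approximate unit argument (`quotientCStarAlgebra`).

The delicate point is that `Δ` maps `A^K` into the closed span of the tensors `A^K ⊗ A`: `Δ(x)`
satisfies the fixed point equation in its first leg, but for spatial tensor products this does not
by itself place it in `A^K ⊗ A`. A conditional expectation settles it. The subgroup inherits
coassociativity and a density condition from `G`, so it carries a left-invariant state `h`, and `E =
(hπ ⊗ ι)Δ` maps `A` into `A^K`, fixes `A^K` pointwise and satisfies `ΔE = (E ⊗ ι)Δ`. Hence `Δ(x) =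
(E ⊗ ι)Δ(x)` for `x` in `A^K` (`comul_mem_range`). The invariant state is obtained by averaging
convolution powers of a state `ω`, which gives a state absorbing `ω`; such a state absorbs
everything dominated by `ω`, and a limit over finite sets of functionals finishes
(`exists_left_invariant_state`).

Injectivity: if `T_χ(c) = 0`, ergodicity makes `(ι ⊗ h)δ(c*c)` a scalar, with `h` now the Haar state
of `G`, and `χ` evaluates that scalar as `h(T_χ(c*c)) = 0`. So `δ(c)` is a null vector of every `φ ⊗
h`; faithfulness of `h` kills its slices, and `c = 0` (`orbitMap_injective`). -/

noncomputable section

namespace CQG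

/-! ### Quotients of C*-algebras by closed ideals -/

section Quotient

variable {A : Type u} [CStarAlgebra A] (I : Ideal A)

/-- A self-adjoint two-sided ideal as a non-unital `*`-subalgebra. -/
def idealStarSubalgebra (hs : ∀ a ∈ I, star a ∈ I) : NonUnitalStarSubalgebra ℂ A where
  carrier := I
  add_mem' := I.add_mem
  zero_mem' := I.zero_mem
  mul_mem' _ hb := I.mul_mem_left _ hb
  smul_mem' c a ha := by
    rw [← one_mul a, ← smul_mul_assoc]
    exact I.mul_mem_left _ ha
  star_mem' ha := hs _ ha

/-- A closed self-adjoint ideal has approximate units of norm at most one. -/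
theorem exists_approx_unit_mem_ideal [hI : IsClosed (I : Set A)] (hs : ∀ a ∈ I, star a ∈ I)
    {j : A} (hj : j ∈ I) {ε : ℝ} (hε : 0 < ε) :
    ∃ e ∈ I, star e = e ∧ ‖1 - e‖ ≤ 1 ∧ ‖j * (1 - e)‖ ≤ ε := by
  let S := idealStarSubalgebra I hs
  have hS : IsClosed (S : Set A) := hI
  let _ : NonUnitalCStarAlgebra S := NonUnitalStarSubalgebra.nonUnitalCStarAlgebra S
  let _ := CStarAlgebra.spectralOrder S
  have _ := CStarAlgebra.spectralOrderedRing S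
  let _ := CStarAlgebra.spectralOrder A
  have _ := CStarAlgebra.spectralOrderedRing A
  -- The ideal is itself a non-unital C*-algebra, so `e` can be taken from its approximate unit.
  -- Then `0 ≤ e ≤ 1` in `A`, whence `‖1 - e‖ ≤ 1`.
  have hu := CStarAlgebra.increasingApproximateUnit S
  have _ := hu.neBot
  have ht := (hu.tendsto_mul_left ⟨j, hj⟩).eventually (Metric.closedBall_mem_nhds _ hε)
  obtain ⟨e, ⟨he0, he1⟩, hej⟩ := ((hu.eventually_nonneg.and hu.eventually_norm).and ht).exists
  -- The orders of `S` and `A` are compared through the form `b* b`, which makes sense in both.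
  have hpos : (0 : A) ≤ e := by
    obtain ⟨b, rfl⟩ := CStarAlgebra.nonneg_iff_eq_star_mul_self.mp he0
    exact star_mul_self_nonneg (b : A)
  have hle : (e : A) ≤ 1 := (CStarAlgebra.norm_le_one_iff_of_nonneg (e : A) hpos).mp he1
  refine ⟨e, e.2, (IsSelfAdjoint.of_nonneg hpos).star_eq, ?_, ?_⟩
  · exact (CStarAlgebra.norm_le_one_iff_of_nonneg _ (sub_nonneg.mpr hle)).mpr
      (sub_le_self _ hpos)
  · rw [dist_eq_norm] at hej
    rw [mul_sub, mul_one, norm_sub_rev]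
    exact hej

variable [I.IsTwoSided]

/-- The quotient of a C*-algebra by a closed self-adjoint two-sided ideal is a C*-algebra. -/
@[reducible]
def quotientCStarAlgebra [hI : IsClosed (I : Set A)] (hs : ∀ a ∈ I, star a ∈ I) :
    CStarAlgebra (A ⧸ I) :=
  have norm_le (a : A) : ‖Ideal.Quotient.mk I a‖ ≤ ‖a‖ := Submodule.Quotient.norm_mk_le I a
  have exists_lift (x : A ⧸ I) {ε : ℝ} (hε : 0 < ε) :
      ∃ a, Ideal.Quotient.mk I a = x ∧ ‖a‖ < ‖x‖ + ε := Submodule.Quotient.norm_mk_lt x hε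
  { Submodule.Quotient.normedAddCommGroup I, Ideal.Quotient.ring I,
    (inferInstance : Algebra ℂ (A ⧸ I)), Submodule.Quotient.completeSpace I with
    norm_mul_le x y := by
      have key : ∀ ε > 0, ‖x * y‖ ≤ (‖x‖ + ε) * (‖y‖ + ε) := fun ε hε => by
        obtain ⟨a, rfl, ha⟩ := exists_lift x hε
        obtain ⟨b, rfl, hb⟩ := exists_lift y hε
        rw [← map_mul]
        exact (norm_le _).trans ((norm_mul_le a b).trans (mul_le_mul ha.le hb.le (norm_nonneg _)
          ((norm_nonneg a).trans ha.le)))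
      have ht : Filter.Tendsto (fun ε : ℝ => (‖x‖ + ε) * (‖y‖ + ε)) (nhdsWithin 0 (Set.Ioi 0))
          (nhds (‖x‖ * ‖y‖)) := by
        have : Continuous fun ε : ℝ => (‖x‖ + ε) * (‖y‖ + ε) := by fun_prop
        simpa using (this.tendsto 0).mono_left nhdsWithin_le_nhds
      exact ge_of_tendsto ht (by filter_upwards [self_mem_nhdsWithin] with ε hε using key ε hε)
    norm_smul_le := (Submodule.Quotient.normedSpace I ℂ).norm_smul_le
    star := Quotient.map' star fun a b hab => by
      rw [Submodule.quotientRel_def] at hab ⊢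
      rw [← star_sub]
      exact hs _ hab
    star_involutive := by
      rintro ⟨a⟩
      exact congrArg (Ideal.Quotient.mk I) (star_star a)
    star_mul := by
      rintro ⟨a⟩ ⟨b⟩
      exact congrArg (Ideal.Quotient.mk I) (star_mul a b)
    star_add := by
      rintro ⟨a⟩ ⟨b⟩
      exact congrArg (Ideal.Quotient.mk I) (star_add a b)
    star_smul := by
      rintro c ⟨a⟩
      exact congrArg (Ideal.Quotient.mk I) (star_smul c a)
    norm_mul_self_le := by
      rintro ⟨a⟩
      change ‖Ideal.Quotient.mk I a‖ * ‖Ideal.Quotient.mk I a‖ ≤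
        ‖Ideal.Quotient.mk I (star a * a)‖
      refine le_of_forall_pos_le_add fun ε hε => ?_
      obtain ⟨b, hb, hlt⟩ := exists_lift (Ideal.Quotient.mk I (star a * a)) (half_pos hε)
      -- Write `a* a = b + j` with `b` a nearly norm-minimal lift and `j ∈ I`. Since `a e ∈ I`, `a(1
      -- - e)` lifts the same class as `a`, and the C*-identity in `A` bounds its squared norm by
      -- `‖b‖ + ‖j(1 - e)‖`; each term costs `ε / 2`.
      have hj : star a * a - b ∈ I := Ideal.Quotient.eq.mp hb.symm
      obtain ⟨e, heI, hes, he1, hje⟩ := exists_approx_unit_mem_ideal I hs hj (half_pos hε)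
      have h1 : ‖Ideal.Quotient.mk I a‖ ≤ ‖a * (1 - e)‖ := by
        have : Ideal.Quotient.mk I a = Ideal.Quotient.mk I (a * (1 - e)) := by
          refine Ideal.Quotient.eq.mpr ?_
          rw [mul_sub, mul_one, sub_sub_cancel]
          exact I.mul_mem_left _ heI
        rw [this]
        exact norm_le _
      have h2 : star (a * (1 - e)) * (a * (1 - e)) =
          (1 - e) * b * (1 - e) + (1 - e) * ((star a * a - b) * (1 - e)) := by
        rw [star_mul, star_sub, star_one, hes]
        noncomm_ring
      calc ‖Ideal.Quotient.mk I a‖ * ‖Ideal.Quotient.mk I a‖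
          ≤ ‖a * (1 - e)‖ * ‖a * (1 - e)‖ := mul_self_le_mul_self (norm_nonneg _) h1
        _ = ‖(1 - e) * b * (1 - e) + (1 - e) * ((star a * a - b) * (1 - e))‖ := by
          rw [← h2, CStarRing.norm_star_mul_self]
        _ ≤ ‖1 - e‖ * ‖b‖ * ‖1 - e‖ + ‖1 - e‖ * ‖(star a * a - b) * (1 - e)‖ :=
          (norm_add_le _ _).trans (add_le_add ((norm_mul_le _ _).trans
            (mul_le_mul_of_nonneg_right (norm_mul_le _ _) (norm_nonneg _))) (norm_mul_le _ _))
        _ ≤ 1 * ‖b‖ * 1 + 1 * (ε / 2) := by gcongr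
        _ ≤ _ := by linarith }

end Quotient

/-! ### Positive functionals: separation, weak-* limits, invariant means -/

namespace PosFunctional

variable {A B : Type u} [CStarAlgebra A] [CStarAlgebra B]

@[ext]
theorem ext {φ ψ : PosFunctional A} (h : ∀ a, φ a = ψ a) : φ = ψ := by
  obtain ⟨f, hf⟩ := φ
  obtain ⟨g, hg⟩ := ψ
  obtain rfl : f = g := ContinuousLinearMap.ext h
  rfl

/-- The pullback of a positive functional along a `*`-homomorphism. -/
def comp (φ : PosFunctional B) (f : A →⋆ₐ[ℂ] B) : PosFunctional A where
  toContinuousLinearMap := φ.toContinuousLinearMap.comp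
    ⟨f.toAlgHom.toLinearMap, SpatialTensor.continuous_hom f⟩
  nonneg' a := by
    change 0 ≤ φ (f (star a * a))
    rw [map_mul, map_star]
    exact φ.nonneg' _

theorem comp_apply (φ : PosFunctional B) (f : A →⋆ₐ[ℂ] B) (a : A) : φ.comp f a = φ (f a) := rfl

/-- A nonnegative multiple of a positive functional. -/
def smul (r : ℂ) (hr : 0 ≤ r) (φ : PosFunctional A) : PosFunctional A where
  toContinuousLinearMap := r • φ.toContinuousLinearMap
  nonneg' a := mul_nonneg hr (φ.nonneg' a)

theorem smul_apply (r : ℂ) (hr : 0 ≤ r) (φ : PosFunctional A) (a : A) :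
    φ.smul r hr a = r * φ a := rfl

/-- A finite sum of positive functionals. -/
def sum {ι : Type*} (s : Finset ι) (φ : ι → PosFunctional A) : PosFunctional A where
  toContinuousLinearMap := ∑ i ∈ s, (φ i).toContinuousLinearMap
  nonneg' a := by
    rw [sum_apply]
    exact Finset.sum_nonneg fun i _ => (φ i).nonneg' a

theorem sum_apply' {ι : Type*} (s : Finset ι) (φ : ι → PosFunctional A) (a : A) :
    sum s φ a = ∑ i ∈ s, φ i a :=
  _root_.sum_apply _ _ _

theorem map_star' (φ : PosFunctional A) (a : A) : φ (star a) = star (φ a) := by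
  obtain ⟨ρ, ξ, hξ⟩ := φ.exists_rep
  rw [hξ, hξ, map_star, ContinuousLinearMap.star_eq_adjoint,
    ContinuousLinearMap.adjoint_inner_right]
  exact (inner_conj_symm _ _).symm

/-- The null vectors of a positive functional are orthogonal to everything. -/
theorem mul_eq_zero_of_null (φ : PosFunctional A) {z : A} (hz : φ (star z * z) = 0) (w : A) :
    φ (w * z) = 0 := by
  obtain ⟨ρ, ξ, hξ⟩ := φ.exists_rep
  have h0 : ρ.π z ξ = 0 := by
    rw [hξ, map_mul, map_star, mul_apply_eq_comp, ContinuousLinearMap.star_eq_adjoint,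
      ContinuousLinearMap.adjoint_inner_right] at hz
    exact inner_self_eq_zero.mp hz
  rw [hξ, map_mul, mul_apply_eq_comp, h0, map_zero, inner_zero_right]

theorem norm_apply_le (φ : PosFunctional A) (h1 : φ 1 = 1) (a : A) : ‖φ a‖ ≤ ‖a‖ := by
  obtain ⟨ρ, ξ, hξ⟩ := φ.exists_rep
  have hn : ‖ξ‖ * ‖ξ‖ = 1 := by
    rw [← SpatialTensor.sq_norm_of_rep hξ, h1, Complex.one_re]
  rw [hξ]
  calc ‖⟪ξ, ρ.π a ξ⟫_ℂ‖ ≤ ‖ξ‖ * ‖ρ.π a ξ‖ := norm_inner_le_norm _ _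
    _ ≤ ‖ξ‖ * (‖a‖ * ‖ξ‖) := by
      gcongr
      exact ((ρ.π a).le_opNorm ξ).trans (mul_le_mul_of_nonneg_right (ρ.norm_le a) (norm_nonneg _))
    _ = ‖a‖ := by rw [mul_left_comm, hn, mul_one]

/-- Positive functionals separate points. -/
theorem eq_zero_of_forall {a : A} (h : ∀ φ : PosFunctional A, φ a = 0) : a = 0 := by
  obtain ⟨ρ, hρ⟩ := exists_rep_norm a
  have h0 : (ρ.π a : ρ.H →ₗ[ℂ] ρ.H) = 0 := by
    rw [← inner_map_self_eq_zero]
    intro ξ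
    rw [← inner_conj_symm]
    exact (congrArg _ (h (ρ.vec ξ))).trans (map_zero _)
  have h1 : ρ.π a = 0 := ContinuousLinearMap.coe_injective h0
  rw [h1, norm_zero] at hρ
  exact norm_le_zero_iff.mp hρ

theorem exists_state [Nontrivial A] : ∃ φ : PosFunctional A, φ 1 = 1 := by
  obtain ⟨f, hf1, hf2⟩ := exists_dual_vector'' ℂ (1 : A)
  have h1 : f 1 = 1 := by rw [hf2, CStarRing.norm_one]; rfl
  exact ⟨⟨f, nonneg_of_norm_le_one f hf1 h1⟩, h1⟩

/-- States have limits along ultrafilters. -/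
theorem exists_limit {ι : Type*} (l : Ultrafilter ι) (φ : ι → PosFunctional A)
    (h1 : ∀ i, φ i 1 = 1) :
    ∃ ψ : PosFunctional A, ∀ a, Filter.Tendsto (fun i => φ i a) l (nhds (ψ a)) := by
  -- Weak-* compactness of the state space, done pointwise: the values at `a` stay in a compact
  -- disc.
  have hlim : ∀ a, ∃ z ∈ Metric.closedBall (0 : ℂ) ‖a‖,
      Filter.Tendsto (fun i => φ i a) l (nhds z) := fun a =>
    (isCompact_closedBall (0 : ℂ) ‖a‖).ultrafilter_le_nhds (l.map fun i => φ i a)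
      (Filter.le_principal_iff.mpr (Filter.mem_map.mpr (Filter.univ_mem' fun i => by
        simpa using (φ i).norm_apply_le (h1 i) a)))
  choose g hg ht using hlim
  let f : A →ₗ[ℂ] ℂ :=
    { toFun := g
      map_add' := fun a b => tendsto_nhds_unique (ht (a + b))
        (((ht a).add (ht b)).congr fun i => (map_add _ a b).symm)
      map_smul' := fun c a => tendsto_nhds_unique (ht (c • a))
        (((ht a).const_mul c).congr fun i => (map_smul (φ i).toContinuousLinearMap c a).symm) }
  refine ⟨⟨f.mkContinuous 1 fun a => ?_, fun a => ?_⟩, ht⟩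
  · rw [one_mul]
    exact mem_closedBall_zero_iff.mp (hg a)
  · exact ge_of_tendsto' (ht (star a * a)) fun i => (φ i).nonneg' a

/-- Every sequence of states has a mean that is invariant under the shift. -/
theorem exists_shift_invariant_mean (p : ℕ → PosFunctional A) (h1 : ∀ k, p k 1 = 1) :
    ∃ ψ : PosFunctional A, ψ 1 = 1 ∧
      ∀ a b, (∀ k, p k b = p (k + 1) a) → ψ b = ψ a := by
  have hpos : ∀ n : ℕ, (0 : ℂ) ≤ ((n : ℂ) + 1)⁻¹ := fun n => by
    have : (0 : ℝ) ≤ ((n : ℝ) + 1)⁻¹ := by positivity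
    have h := Complex.zero_le_real.mpr this
    push_cast at h
    exact h
  -- Cesàro means of `n + 1` terms, so that each of them is a state, including the one at `n = 0`.
  let q : ℕ → PosFunctional A := fun n => (sum (Finset.range (n + 1)) p).smul _ (hpos n)
  have hq : ∀ n a, q n a = ((n : ℂ) + 1)⁻¹ * ∑ k ∈ Finset.range (n + 1), p k a := fun n a => by
    rw [smul_apply, sum_apply']
  have hq1 : ∀ n, q n 1 = 1 := fun n => by
    rw [hq, Finset.sum_congr rfl fun k _ => h1 k]
    simp [Nat.cast_add_one_ne_zero n]
  obtain ⟨ψ, hψ⟩ := exists_limit (Filter.hyperfilter ℕ) q hq1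
  refine ⟨ψ, tendsto_nhds_unique (hψ 1) (by simp only [hq1]; exact tendsto_const_nhds), ?_⟩
  intro a b hab
  -- The sum telescopes and leaves two boundary terms of size at most `‖a‖`, which the division by
  -- `n + 1` sends to zero.
  have hdiff : ∀ n, q n b - q n a = ((n : ℂ) + 1)⁻¹ * (p (n + 1) a - p 0 a) := fun n => by
    rw [hq, hq, ← mul_sub, ← Finset.sum_sub_distrib, ← Finset.sum_range_sub (fun k => p k a)]
    simp only [hab]
  have hzero : Filter.Tendsto (fun n => q n b - q n a) Filter.atTop (nhds 0) := by
    rw [tendsto_zero_iff_norm_tendsto_zero]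
    have hb : Filter.Tendsto (fun n : ℕ => 1 / ((n : ℝ) + 1) * (‖a‖ + ‖a‖)) Filter.atTop
        (nhds 0) := by
      simpa using tendsto_one_div_add_atTop_nhds_zero_nat.mul_const (‖a‖ + ‖a‖)
    refine squeeze_zero (fun _ => norm_nonneg _) (fun n => ?_) hb
    rw [hdiff, norm_mul, norm_inv, one_div]
    have hn : ‖(n : ℂ) + 1‖ = (n : ℝ) + 1 := by
      have := Complex.norm_natCast (n + 1)
      push_cast at this
      exact this
    rw [hn]
    gcongr
    exact (norm_sub_le _ _).trans
      (add_le_add ((p _).norm_apply_le (h1 _) a) ((p _).norm_apply_le (h1 _) a))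
  have hzero' : Filter.Tendsto (fun n => q n b - q n a) (Filter.hyperfilter ℕ) (nhds 0) :=
    hzero.mono_left (Nat.hyperfilter_le_atTop)
  exact sub_eq_zero.mp (tendsto_nhds_unique ((hψ b).sub (hψ a)) hzero')

end PosFunctional

/-! ### Slice maps and functoriality of the spatial tensor product -/

namespace SpatialTensor

variable {A B C A' B' C' : Type u} [CStarAlgebra A] [CStarAlgebra B] [CStarAlgebra C]
  [CStarAlgebra A'] [CStarAlgebra B'] [CStarAlgebra C']

theorem clm_ext {F : Type*} [NormedAddCommGroup F] [NormedSpace ℂ F]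
    {f g : SpatialTensor A B →L[ℂ] F} (h : ∀ a b, f (tmul a b) = g (tmul a b)) : f = g := by
  ext x
  exact induction_tmul x (p := fun x => f x = g x) (isClosed_eq f.continuous g.continuous)
    (by simp) (fun x y hx hy => by rw [map_add, map_add, hx, hy]) h

/-- A `*`-homomorphism as a continuous linear map. -/
def homCLM {E F : Type*} [CStarAlgebra E] [CStarAlgebra F] (f : E →⋆ₐ[ℂ] F) : E →L[ℂ] F :=
  ⟨f.toAlgHom.toLinearMap, continuous_hom f⟩

theorem homCLM_apply {E F : Type*} [CStarAlgebra E] [CStarAlgebra F] (f : E →⋆ₐ[ℂ] F) (x : E) :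
    homCLM f x = f x := rfl

/-- The map `x ↦ x ⊗ b`. -/
def tmulRightCLM (A : Type u) [CStarAlgebra A] (b : B) : A →L[ℂ] SpatialTensor A B :=
  LinearMap.mkContinuous
    { toFun := fun a => tmul a b
      map_add' := fun a a' => add_tmul a a' b
      map_smul' := fun c a => smul_tmul c a b } ‖b‖
    fun a => (norm_tmul_le a b).trans (mul_comm _ _).le

theorem tmulRightCLM_apply (a : A) (b : B) : tmulRightCLM A b a = tmul a b := rfl

theorem clm_ext₃ {F : Type*} [NormedAddCommGroup F] [NormedSpace ℂ F]
    {f g : SpatialTensor (SpatialTensor A B) C →L[ℂ] F}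
    (h : ∀ a b c, f (tmul (tmul a b) c) = g (tmul (tmul a b) c)) : f = g :=
  clm_ext fun x c => DFunLike.congr_fun (clm_ext (f := f.comp (tmulRightCLM _ c))
    (g := g.comp (tmulRightCLM _ c)) fun a b => h a b c) x

theorem map_map (f' : A' →⋆ₐ[ℂ] C) (f : A →⋆ₐ[ℂ] A') (g' : B' →⋆ₐ[ℂ] C') (g : B →⋆ₐ[ℂ] B')
    (x : SpatialTensor A B) : map f' g' (map f g x) = map (f'.comp f) (g'.comp g) x :=
  DFunLike.congr_fun (clm_ext (f := (homCLM (map f' g')).comp (homCLM (map f g)))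
    (g := homCLM (map (f'.comp f) (g'.comp g))) fun a b => by
      simp only [ContinuousLinearMap.comp_apply, homCLM_apply, map_tmul, StarAlgHom.comp_apply]) x

theorem assoc_map (f : A →⋆ₐ[ℂ] A') (g : B →⋆ₐ[ℂ] B') (k : C →⋆ₐ[ℂ] C')
    (x : SpatialTensor (SpatialTensor A B) C) :
    assoc (map (map f g) k x) = map f (map g k) (assoc x) :=
  DFunLike.congr_fun (clm_ext₃ (f := (homCLM assoc).comp (homCLM (map (map f g) k)))
    (g := (homCLM (map f (map g k))).comp (homCLM assoc)) fun a b c => by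
      simp only [ContinuousLinearMap.comp_apply, homCLM_apply, map_tmul, assoc_tmul]) x

theorem leftSlice_map (φ : PosFunctional A') (f : A →⋆ₐ[ℂ] A') (g : B →⋆ₐ[ℂ] B')
    (x : SpatialTensor A B) : leftSlice φ (map f g x) = g (leftSlice (φ.comp f) x) :=
  DFunLike.congr_fun (clm_ext (f := (leftSlice φ).comp (homCLM (map f g)))
    (g := (homCLM g).comp (leftSlice (φ.comp f))) fun a b => by
      simp only [ContinuousLinearMap.comp_apply, homCLM_apply, map_tmul, leftSlice_tmul, map_smul,
        PosFunctional.comp_apply]) x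

theorem rightSlice_map (ψ : PosFunctional B') (f : A →⋆ₐ[ℂ] A') (g : B →⋆ₐ[ℂ] B')
    (x : SpatialTensor A B) : rightSlice ψ (map f g x) = f (rightSlice (ψ.comp g) x) :=
  DFunLike.congr_fun (clm_ext (f := (rightSlice ψ).comp (homCLM (map f g)))
    (g := (homCLM f).comp (rightSlice (ψ.comp g))) fun a b => by
      simp only [ContinuousLinearMap.comp_apply, homCLM_apply, map_tmul, rightSlice_tmul, map_smul,
        PosFunctional.comp_apply]) x

theorem slice_comm (φ : PosFunctional A) (ψ : PosFunctional B) (x : SpatialTensor A B) :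
    ψ (leftSlice φ x) = φ (rightSlice ψ x) :=
  DFunLike.congr_fun (clm_ext (f := ψ.toContinuousLinearMap.comp (leftSlice φ))
    (g := φ.toContinuousLinearMap.comp (rightSlice ψ)) fun a b => by
      simp only [ContinuousLinearMap.comp_apply, leftSlice_tmul, rightSlice_tmul, map_smul,
        smul_eq_mul, mul_comm]) x

/-- With `leftSlice_mul_one_tmul`, this makes `φ ⊗ ι` a bimodule map over `1 ⊗ B`. It lets
expressions such as `(φ ⊗ h)(z* z)` be expanded, and `y* y` be read as a slice when `y` is one. -/
theorem leftSlice_one_tmul_mul (φ : PosFunctional A) (b : B) (x : SpatialTensor A B) :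
    leftSlice φ (tmul 1 b * x) = b * leftSlice φ x :=
  DFunLike.congr_fun (clm_ext
    (f := (leftSlice φ).comp (ContinuousLinearMap.mul ℂ (SpatialTensor A B) (tmul 1 b)))
    (g := (ContinuousLinearMap.mul ℂ B b).comp (leftSlice φ)) fun a c => by
      simp only [ContinuousLinearMap.comp_apply, ContinuousLinearMap.mul_apply', tmul_mul_tmul,
        leftSlice_tmul, one_mul, mul_smul_comm]) x

theorem leftSlice_star (φ : PosFunctional A) (x : SpatialTensor A B) :
    leftSlice φ (star x) = star (leftSlice φ x) := by
  -- Both sides are conjugate-linear, so `clm_ext` does not apply.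
  refine induction_tmul x (p := fun x => leftSlice φ (star x) = star (leftSlice φ x))
    (isClosed_eq (by fun_prop) (by fun_prop)) (by simp)
    (fun x y hx hy => by rw [star_add, map_add, map_add, star_add, hx, hy]) fun a b => ?_
  rw [star_tmul, leftSlice_tmul, leftSlice_tmul, star_smul, φ.map_star']

theorem leftSlice_mul_one_tmul (φ : PosFunctional A) (b : B) (x : SpatialTensor A B) :
    leftSlice φ (x * tmul 1 b) = leftSlice φ x * b := by
  have h : x * tmul 1 b = star (tmul 1 (star b) * star x) := by
    rw [star_mul, star_star, star_tmul, star_one, star_star]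
  rw [h, leftSlice_star, leftSlice_one_tmul_mul, leftSlice_star, star_mul, star_star, star_star]

/-- The positive functional `φ ⊗ ψ` on the spatial tensor product. -/
def prodFunctional (φ : PosFunctional A) (ψ : PosFunctional B) :
    PosFunctional (SpatialTensor A B) where
  toContinuousLinearMap := ψ.toContinuousLinearMap.comp (leftSlice φ)
  nonneg' x := by
    obtain ⟨ρ, ξ, hξ⟩ := φ.exists_rep
    obtain ⟨σ, η, hη⟩ := ψ.exists_rep
    -- Positivity comes from GNS: `φ ⊗ ψ` is the vector functional of `ρ ⊗ σ` at `ξ ⊗ η`.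
    let τ : Rep (SpatialTensor A B) := ⟨HilbertTensor ρ.H σ.H, rep ρ σ⟩
    let ζ : τ.H := HilbertTensor.of (ξ ⊗ₜ[ℂ] η)
    have h : ψ.toContinuousLinearMap.comp (leftSlice φ) = (τ.vec ζ).toContinuousLinearMap :=
      clm_ext fun a b => by
        change ψ (leftSlice φ (tmul a b)) = ⟪HilbertTensor.of (ξ ⊗ₜ[ℂ] η),
          rep ρ σ (tmul a b) (HilbertTensor.of (ξ ⊗ₜ[ℂ] η))⟫_ℂ
        rw [rep_tmul, leftSlice_tmul, opTensor_of, LinearIsometry.inner_map_map,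
          TensorProduct.mapL_tmul, TensorProduct.inner_tmul, map_smul, smul_eq_mul, hξ, hη]
    rw [h]
    exact (τ.vec ζ).nonneg' x

theorem prodFunctional_apply (φ : PosFunctional A) (ψ : PosFunctional B)
    (x : SpatialTensor A B) : prodFunctional φ ψ x = ψ (leftSlice φ x) := rfl

theorem leftSlice_leftSlice_assoc (φ : PosFunctional A) (ψ : PosFunctional B)
    (x : SpatialTensor (SpatialTensor A B) C) :
    leftSlice ψ (leftSlice φ (assoc x)) = leftSlice (prodFunctional φ ψ) x :=
  DFunLike.congr_fun (clm_ext₃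
    (f := (leftSlice ψ).comp ((leftSlice φ).comp (homCLM assoc)))
    (g := leftSlice (prodFunctional φ ψ)) fun a b c => by
      simp only [ContinuousLinearMap.comp_apply, homCLM_apply, assoc_tmul, leftSlice_tmul,
        prodFunctional_apply, map_smul, smul_eq_mul, mul_smul]) x

/-- Evaluates `φ ⊗ ι ⊗ ι` with the last leg as a spectator. In this way `E_φ ⊗ ι` can be handled
although `E_φ` need not be multiplicative and `map` accepts only `*`-homomorphisms. -/
theorem leftSlice_assoc_tmul (φ : PosFunctional A) (x : SpatialTensor A B) (c : C) :
    leftSlice φ (assoc (tmul x c)) = tmul (leftSlice φ x) c :=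
  DFunLike.congr_fun (clm_ext
    (f := ((leftSlice φ).comp (homCLM assoc)).comp (tmulRightCLM _ c))
    (g := (tmulRightCLM _ c).comp (leftSlice φ)) fun a b => by
      simp only [ContinuousLinearMap.comp_apply, homCLM_apply, tmulRightCLM_apply, assoc_tmul,
        leftSlice_tmul, smul_tmul]) x

/-- The spatial tensor product preserves injectivity in the first variable. -/
theorem map_id_injective {f : A →⋆ₐ[ℂ] A'} (hf : Function.Injective f) :
    Function.Injective (map f (StarAlgHom.id ℂ B)) := by
  rw [injective_iff_map_eq_zero]
  intro x hx
  refine eq_zero_of_slices x fun φ ψ => ?_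
  -- Right slices commute with `f`, so injectivity of `f` kills every right slice of `x`, and slices
  -- separate points.
  have h : f (rightSlice ψ x) = 0 := by
    have := rightSlice_map ψ f (StarAlgHom.id ℂ B) x
    rw [hx, map_zero] at this
    exact this.symm
  rw [slice_comm, (injective_iff_map_eq_zero f).mp hf _ h, map_zero]

theorem isClosed_range_of_injective {E F : Type*} [CStarAlgebra E] [CStarAlgebra F]
    {f : E →⋆ₐ[ℂ] F} (hf : Function.Injective f) : IsClosed (Set.range f) :=
  (NonUnitalStarAlgHom.isometry f hf).isClosedEmbedding.isClosed_range

theorem map_surjective_dense (f : A →⋆ₐ[ℂ] A') (g : B →⋆ₐ[ℂ] B') (hf : Function.Surjective f)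
    (hg : Function.Surjective g) : DenseRange (map f g) := by
  intro x
  refine induction_tmul x (p := fun x => x ∈ closure (Set.range (map f g))) isClosed_closure
    (subset_closure ⟨0, map_zero _⟩) (fun x y hx hy => ?_) fun a b => ?_
  · exact (homCLM (map f g)).range.topologicalClosure.add_mem hx hy
  · obtain ⟨a, rfl⟩ := hf a
    obtain ⟨b, rfl⟩ := hg b
    exact subset_closure ⟨tmul a b, map_tmul f g a b⟩

end SpatialTensor

open SpatialTensor

/-! ### Convolution and existence of a left-invariant state -/

section Haar

variable {B : Type u} [CStarAlgebra B] (Δ : B →⋆ₐ[ℂ] SpatialTensor B B)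

/-- The convolution `(φ ⊗ ψ) ∘ Δ` of positive functionals. -/
def conv (φ ψ : PosFunctional B) : PosFunctional B := (prodFunctional φ ψ).comp Δ

theorem conv_apply (φ ψ : PosFunctional B) (b : B) : conv Δ φ ψ b = ψ (leftSlice φ (Δ b)) := rfl

theorem conv_apply' (φ ψ : PosFunctional B) (b : B) : conv Δ φ ψ b = φ (rightSlice ψ (Δ b)) :=
  slice_comm φ ψ _

theorem conv_one {φ ψ : PosFunctional B} (hφ : φ 1 = 1) (hψ : ψ 1 = 1) : conv Δ φ ψ 1 = 1 := by
  rw [conv_apply, map_one, one_eq_tmul, leftSlice_tmul, hφ, one_smul, hψ]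

variable {Δ}

/-- Coassociativity in the form `E_ψ ∘ E_φ = E_{φ * ψ}`, where `E_φ = (φ ⊗ ι)Δ`. -/
theorem leftSlice_conv
    (hco : ∀ b, assoc (map Δ (StarAlgHom.id ℂ B) (Δ b)) = map (StarAlgHom.id ℂ B) Δ (Δ b))
    (φ ψ : PosFunctional B) (b : B) :
    leftSlice ψ (Δ (leftSlice φ (Δ b))) = leftSlice (conv Δ φ ψ) (Δ b) := by
  have h1 : Δ (leftSlice φ (Δ b)) = leftSlice φ (map (StarAlgHom.id ℂ B) Δ (Δ b)) :=
    (leftSlice_map φ (StarAlgHom.id ℂ B) Δ (Δ b)).symm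
  rw [h1, ← hco, leftSlice_leftSlice_assoc, leftSlice_map]
  rfl

theorem conv_assoc
    (hco : ∀ b, assoc (map Δ (StarAlgHom.id ℂ B) (Δ b)) = map (StarAlgHom.id ℂ B) Δ (Δ b))
    (φ ψ ω : PosFunctional B) :
    conv Δ (conv Δ φ ψ) ω = conv Δ φ (conv Δ ψ ω) := by
  ext b
  rw [conv_apply, ← leftSlice_conv hco, conv_apply, conv_apply]

/-- For every state `ω` there is a state that absorbs `ω` on both sides. -/
theorem exists_absorbing_state
    (hco : ∀ b, assoc (map Δ (StarAlgHom.id ℂ B) (Δ b)) = map (StarAlgHom.id ℂ B) Δ (Δ b))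
    (ω : PosFunctional B) (hω : ω 1 = 1) :
    ∃ h : PosFunctional B, h 1 = 1 ∧ conv Δ h ω = h ∧ conv Δ ω h = h := by
  -- `p n` is the convolution power `ω^(n+1)`: without a counit there is no zeroth power to start
  -- from.
  let p : ℕ → PosFunctional B := fun n => Nat.rec ω (fun _ φ => conv Δ φ ω) n
  have hp : ∀ n, p (n + 1) = conv Δ (p n) ω := fun _ => rfl
  have hp' : ∀ n, p (n + 1) = conv Δ ω (p n) := fun n => by
    induction n with
    | zero => rfl
    | succ n ih => exact (congrArg (conv Δ · ω) ih).trans (conv_assoc hco ω (p n) ω)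
  have hp1 : ∀ n, p n 1 = 1 := fun n => by
    induction n with
    | zero => exact hω
    | succ n ih => rw [hp, conv_one Δ ih hω]
  obtain ⟨h, h1, hinv⟩ := PosFunctional.exists_shift_invariant_mean p hp1
  refine ⟨h, h1, ?_, ?_⟩
  · ext b
    rw [conv_apply']
    exact hinv b _ fun k => by rw [hp, conv_apply']
  · ext b
    rw [conv_apply]
    exact hinv b _ fun k => by rw [hp', conv_apply]

/-- A state that absorbs `ω` absorbs every positive functional dominated by `ω`. -/
theorem absorbs_of_dominated
    (hco : ∀ b, assoc (map Δ (StarAlgHom.id ℂ B) (Δ b)) = map (StarAlgHom.id ℂ B) Δ (Δ b))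
    (hd : Dense (Submodule.span ℂ {x | ∃ b c : B, x = tmul 1 b * Δ c} :
      Set (SpatialTensor B B)))
    {ω h ρ ρ' : PosFunctional B} (hω : ω 1 = 1) (h1 : h 1 = 1)
    (hr : conv Δ h ω = h) (hl : conv Δ ω h = h) (N : ℂ) (hN : ∀ b, ρ b + ρ' b = N * ω b) (b : B) :
    conv Δ h ρ b = ρ 1 * h b := by
  have hsum : ∀ x : SpatialTensor B B,
      prodFunctional ρ h x + prodFunctional ρ' h x = N * prodFunctional ω h x := fun x => by
    simp only [prodFunctional_apply, slice_comm]
    exact hN _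
  have key : ∀ a c, h (leftSlice (conv Δ h ρ) (tmul 1 c * Δ a)) =
      ρ 1 * h (leftSlice h (tmul 1 c * Δ a)) := by
    intro a c
    set y := leftSlice h (Δ a) with hy
    have hyω : leftSlice ω (Δ y) = y := by rw [hy, leftSlice_conv hco, hr]
    -- `z` measures the failure of `Δ(y) = 1 ⊗ y`. In `(ω ⊗ h)(z* z)` the first term is `(ω * h)(y*
    -- y) = h(y* y)`, and the other three are `-h(y* y)`, `-h(y* y)`, `+h(y* y)` because `E_ω(y) =
    -- y`. So the total is zero.
    set z := Δ y - tmul 1 y with hz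
    have hzz : star z * z = Δ (star y * y) - star (Δ y) * tmul 1 y - tmul 1 (star y) * Δ y +
        tmul 1 (star y * y) := by
      have e1 : star (tmul (1 : B) y) = tmul 1 (star y) := by rw [star_tmul, star_one]
      have e2 : tmul (1 : B) (star y * y) = tmul 1 (star y) * tmul 1 y := by
        rw [tmul_mul_tmul, one_mul]
      rw [hz, star_sub, e1, e2, map_mul, map_star]
      noncomm_ring
    have hnull : prodFunctional ω h (star z * z) = 0 := by
      rw [prodFunctional_apply, hzz, map_add, map_sub, map_sub, leftSlice_mul_one_tmul,
        leftSlice_one_tmul_mul, leftSlice_star, hyω, leftSlice_tmul, hω, one_smul,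
        sub_add_cancel, map_sub, ← conv_apply, hl, sub_self]
    -- Domination passes to `ρ ⊗ h`: two nonnegative numbers adding up to zero both vanish.
    have hnull' : prodFunctional ρ h (star z * z) = 0 := by
      have hs := hsum (star z * z)
      rw [hnull, mul_zero] at hs
      exact ((add_eq_zero_iff_of_nonneg ((prodFunctional ρ h).nonneg' z)
        ((prodFunctional ρ' h).nonneg' z)).mp hs).1
    -- Cauchy–Schwarz gives `(ρ ⊗ h)((1 ⊗ c)z) = 0`, that is `h(c E_ρ(y)) = ρ(1) h(c y)`.
    have h0 := (prodFunctional ρ h).mul_eq_zero_of_null hnull' (tmul 1 c)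
    rw [hz, mul_sub, tmul_mul_tmul, one_mul, prodFunctional_apply, map_sub,
      leftSlice_one_tmul_mul, leftSlice_tmul, map_sub, map_smul, sub_eq_zero, hy,
      leftSlice_conv hco] at h0
    rw [leftSlice_one_tmul_mul, leftSlice_one_tmul_mul, h0, smul_eq_mul]
  have hext : h.toContinuousLinearMap.comp (leftSlice (conv Δ h ρ)) =
      ρ 1 • h.toContinuousLinearMap.comp (leftSlice h) := by
    refine ContinuousLinearMap.ext_on hd ?_
    rintro _ ⟨c, a, rfl⟩
    exact key a c
  -- By density the identity holds on all of `B ⊗ B`; at `b ⊗ 1` the outer `h` contributes only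
  -- `h(1) = 1`.
  have := DFunLike.congr_fun hext (tmul b 1)
  change h (leftSlice (conv Δ h ρ) (tmul b 1)) = ρ 1 * h (leftSlice h (tmul b 1)) at this
  simpa only [leftSlice_tmul, map_smul, h1, smul_eq_mul, mul_one] using this

/-- Existence of a left-invariant state. -/
theorem exists_left_invariant_state [Nontrivial B]
    (hco : ∀ b, assoc (map Δ (StarAlgHom.id ℂ B) (Δ b)) = map (StarAlgHom.id ℂ B) Δ (Δ b))
    (hd : Dense (Submodule.span ℂ {x | ∃ b c : B, x = tmul 1 b * Δ c} :
      Set (SpatialTensor B B))) :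
    ∃ h : PosFunctional B, h 1 = 1 ∧ ∀ b, leftSlice h (Δ b) = h b • (1 : B) := by
  classical
  obtain ⟨σ, hσ⟩ := PosFunctional.exists_state (A := B)
  have hfin : ∀ F : Finset (PosFunctional B), ∃ h : PosFunctional B, h 1 = 1 ∧
      ∀ ρ ∈ F, ∀ b, conv Δ h ρ b = ρ 1 * h b := by
    intro F
    -- The state `σ` is added so that the total mass `N` is nonzero and `ω`, the normalized sum over
    -- `S`, is a state. Every `ρ ∈ F` is then dominated by `N ω`.
    let S : Finset (PosFunctional B) := insert σ F
    let N : ℂ := PosFunctional.sum S id 1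
    have h0 : ∀ φ : PosFunctional B, 0 ≤ φ 1 := fun φ => by
      simpa using φ.nonneg' 1
    have hN0 : 0 ≤ N := h0 _
    have hN : N ≠ 0 := by
      intro hN
      have hs : ∑ φ ∈ S, φ 1 = 0 := (PosFunctional.sum_apply' S id 1).symm.trans hN
      have := (Finset.sum_eq_zero_iff_of_nonneg fun φ _ => h0 φ).mp hs σ
        (Finset.mem_insert_self _ _)
      exact one_ne_zero (hσ.symm.trans this)
    let ω : PosFunctional B := (PosFunctional.sum S id).smul N⁻¹ (inv_nonneg.mpr hN0)
    have hω : ω 1 = 1 := inv_mul_cancel₀ hN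
    obtain ⟨h, h1, hr, hl⟩ := exists_absorbing_state hco ω hω
    refine ⟨h, h1, fun ρ hρ => absorbs_of_dominated hco hd (ρ' := PosFunctional.sum (S.erase ρ) id)
      hω h1 hr hl N fun b => ?_⟩
    rw [PosFunctional.smul_apply, mul_inv_cancel_left₀ hN, PosFunctional.sum_apply',
      PosFunctional.sum_apply']
    exact Finset.add_sum_erase S (fun φ : PosFunctional B => φ b) (Finset.mem_insert_of_mem hρ)
  choose k hk1 hk using hfin
  obtain ⟨h, hlim⟩ := PosFunctional.exists_limit (Ultrafilter.of Filter.atTop) k hk1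
  refine ⟨h, tendsto_nhds_unique (hlim 1) (by simp only [hk1]; exact tendsto_const_nhds),
    fun b => sub_eq_zero.mp (PosFunctional.eq_zero_of_forall fun ρ => ?_)⟩
  -- A given `ρ` lies in all sufficiently large finite sets `F`, so the limit state absorbs every
  -- `ρ`.
  have hev : ∀ᶠ F in (Ultrafilter.of (Filter.atTop : Filter (Finset (PosFunctional B))) : Filter _),
      ρ 1 * k F b = k F (rightSlice ρ (Δ b)) := by
    refine Ultrafilter.of_le _ ?_
    filter_upwards [Filter.eventually_ge_atTop {ρ}] with F hF
    rw [← conv_apply']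
    exact (hk F ρ (hF (Finset.mem_singleton_self ρ)) b).symm
  have heq : h (rightSlice ρ (Δ b)) = ρ 1 * h b :=
    tendsto_nhds_unique (hlim _) (((hlim b).const_mul (ρ 1)).congr' hev)
  rw [map_sub, slice_comm, heq, map_smul, smul_eq_mul, mul_comm, sub_self]

end Haar

/-! ### The quotient space and the restricted coproduct -/

namespace QuantumSubgroup

variable {A : Type u} [CStarAlgebra A] {G : CompactQuantumGroup A} (K : QuantumSubgroup G)

/-- Inherited from `G`: `π` is onto and intertwines the coproducts. With `dense_right` it supplies
what the existence of an invariant state on the subgroup requires. -/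
theorem coassoc (b : K.carrier) :
    assoc (map K.Δ' (StarAlgHom.id ℂ K.carrier) (K.Δ' b)) =
      map (StarAlgHom.id ℂ K.carrier) K.Δ' (K.Δ' b) := by
  obtain ⟨a, rfl⟩ := K.surjective b
  have hc : K.Δ'.comp K.π = (map K.π K.π).comp G.Δ := StarAlgHom.ext fun a => (K.compat a).symm
  have h1 : map K.Δ' (StarAlgHom.id ℂ K.carrier) (map K.π K.π (G.Δ a)) =
      map (map K.π K.π) K.π (map G.Δ (StarAlgHom.id ℂ A) (G.Δ a)) := by
    rw [map_map, map_map, hc]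
    rfl
  have h2 : map (StarAlgHom.id ℂ K.carrier) K.Δ' (map K.π K.π (G.Δ a)) =
      map K.π (map K.π K.π) (map (StarAlgHom.id ℂ A) G.Δ (G.Δ a)) := by
    rw [map_map, map_map, hc]
    rfl
  rw [← K.compat, h1, h2, assoc_map, G.coassoc]

theorem dense_right : Dense (Submodule.span ℂ {x | ∃ b c : K.carrier, x = tmul 1 b * K.Δ' c} :
    Set (SpatialTensor K.carrier K.carrier)) := by
  have h := (map_surjective_dense K.π K.π K.surjective K.surjective).dense_image
    (continuous_hom _) G.dense_right
  refine h.mono ?_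
  rintro _ ⟨x, hx, rfl⟩
  have hle : Submodule.span ℂ {x | ∃ b c : A, x = tmul 1 b * G.Δ c} ≤
      (Submodule.span ℂ {x | ∃ b c : K.carrier, x = tmul 1 b * K.Δ' c}).comap
        (map K.π K.π).toAlgHom.toLinearMap := by
    refine Submodule.span_le.mpr ?_
    rintro _ ⟨b, c, rfl⟩
    refine Submodule.subset_span ⟨K.π b, K.π c, ?_⟩
    change map K.π K.π (tmul 1 b * G.Δ c) = _
    rw [map_mul, map_tmul, map_one, K.compat]
  exact hle hx

/-- The inclusion `A^K ⊗ A → A ⊗ A`. -/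
abbrev cosetInclusion : SpatialTensor K.rightCoset A →⋆ₐ[ℂ] SpatialTensor A A :=
  map K.rightCoset.subtype (StarAlgHom.id ℂ A)

theorem cosetInclusion_injective : Function.Injective K.cosetInclusion :=
  map_id_injective Subtype.val_injective

/-- The coproduct restricts to a map `A^K → A^K ⊗ A`. -/
theorem comul_mem_range (x : K.rightCoset) : G.Δ x ∈ Set.range K.cosetInclusion := by
  have hcl : IsClosed (Set.range K.cosetInclusion) :=
    isClosed_range_of_injective K.cosetInclusion_injective
  -- The zero algebra has no state, but there the fixed point condition is vacuous and `A^K = A`.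
  rcases subsingleton_or_nontrivial K.carrier with hK | hK
  · have hsub : Subsingleton (SpatialTensor K.carrier A) := by
      refine subsingleton_of_zero_eq_one ?_
      rw [one_eq_tmul, Subsingleton.elim (1 : K.carrier) ((0 : ℂ) • 1), smul_tmul, zero_smul]
    refine induction_tmul (G.Δ x) (p := fun y => y ∈ Set.range K.cosetInclusion) hcl
      ⟨0, map_zero _⟩ ?_ fun a b => ?_
    · rintro _ _ ⟨y, rfl⟩ ⟨z, rfl⟩
      exact ⟨y + z, map_add _ _ _⟩
    · exact ⟨tmul ⟨a, (K.mem_rightCoset a).mpr (Subsingleton.elim _ _)⟩ b, map_tmul _ _ _ _⟩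
  obtain ⟨h, h1, hinv⟩ := exists_left_invariant_state K.coassoc K.dense_right
  let ψ : PosFunctional A := h.comp K.π
  -- Here `E = (hπ ⊗ ι)Δ`. By coassociativity `(π ⊗ ι)ΔE(a) = (πE ⊗ ι)Δ(a)`, and invariance of `h`
  -- gives `πE(b) = (h ⊗ ι)Δ'(π b) = h(π b)1`; together these yield `1 ⊗ E(a)`.
  have hE : ∀ a, leftSlice ψ (G.Δ a) ∈ K.rightCoset := fun a => by
    rw [mem_rightCoset]
    have e1 : G.Δ (leftSlice ψ (G.Δ a)) =
        leftSlice ψ (assoc (map G.Δ (StarAlgHom.id ℂ A) (G.Δ a))) := by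
      rw [G.coassoc, leftSlice_map]
      rfl
    have e2 : ∀ y : SpatialTensor A A, map K.π (StarAlgHom.id ℂ A)
        (leftSlice ψ (assoc (map G.Δ (StarAlgHom.id ℂ A) y))) = tmul 1 (leftSlice ψ y) := by
      intro y
      refine DFunLike.congr_fun (clm_ext
        (f := (homCLM (map K.π (StarAlgHom.id ℂ A))).comp ((leftSlice ψ).comp
          ((homCLM assoc).comp (homCLM (map G.Δ (StarAlgHom.id ℂ A))))))
        (g := (homCLM (inclRight K.carrier A)).comp (leftSlice ψ)) fun b c => ?_) y
      change map K.π (StarAlgHom.id ℂ A)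
        (leftSlice ψ (assoc (map G.Δ (StarAlgHom.id ℂ A) (tmul b c)))) =
          tmul 1 (leftSlice ψ (tmul b c))
      have e3 : K.π (leftSlice ψ (G.Δ b)) = h (K.π b) • (1 : K.carrier) := by
        rw [← hinv, ← K.compat, leftSlice_map]
      rw [map_tmul, leftSlice_assoc_tmul, map_tmul, e3, leftSlice_tmul, tmul_smul, smul_tmul]
      rfl
    rw [e1, e2]
  -- The displayed map is `E ⊗ ι`. It sends `a ⊗ b` to `E(a) ⊗ b`, and the range of an injective
  -- `*`-homomorphism is closed.
  have hrange : ∀ y : SpatialTensor A A,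
      leftSlice ψ (assoc (map G.Δ (StarAlgHom.id ℂ A) y)) ∈ Set.range K.cosetInclusion := by
    intro y
    have hcont : Continuous fun y : SpatialTensor A A =>
        leftSlice ψ (assoc (map G.Δ (StarAlgHom.id ℂ A) y)) :=
      (leftSlice ψ).continuous.comp ((continuous_hom _).comp (continuous_hom _))
    refine induction_tmul y (p := fun y =>
      leftSlice ψ (assoc (map G.Δ (StarAlgHom.id ℂ A) y)) ∈ Set.range K.cosetInclusion)
      (hcl.preimage hcont) ⟨0, by simp⟩ ?_ fun a b => ?_
    · rintro y z ⟨u, hu⟩ ⟨v, hv⟩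
      exact ⟨u + v, by simp only [map_add, hu, hv]⟩
    · refine ⟨tmul ⟨_, hE a⟩ b, ?_⟩
      rw [map_tmul, map_tmul, leftSlice_assoc_tmul]
      rfl
  -- `E` fixes `x`, since `E(x) = (h ⊗ ι)(1 ⊗ x) = x`; hence `(E ⊗ ι)Δ(x) = Δ(E(x)) = Δ(x)`.
  have hx : leftSlice ψ (assoc (map G.Δ (StarAlgHom.id ℂ A) (G.Δ x))) = G.Δ x := by
    have e1 : leftSlice ψ (G.Δ (x : A)) = x := by
      have e2 := leftSlice_map h K.π (StarAlgHom.id ℂ A) (G.Δ (x : A))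
      rw [(K.mem_rightCoset x).mp x.2, leftSlice_tmul, h1, one_smul] at e2
      exact e2.symm
    rw [G.coassoc, leftSlice_map]
    exact congrArg G.Δ e1
  rw [← hx]
  exact hrange _

/-- The restriction of the coproduct to `A^K`. -/
def cosetComul : K.rightCoset →⋆ₐ[ℂ] SpatialTensor K.rightCoset A :=
  (StarAlgHomClass.toStarAlgHom
    (StarAlgEquiv.ofInjective K.cosetInclusion K.cosetInclusion_injective).symm).comp
    ((G.Δ.comp K.rightCoset.subtype).codRestrict K.cosetInclusion.range K.comul_mem_range)

theorem cosetInclusion_cosetComul (x : K.rightCoset) :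
    K.cosetInclusion (K.cosetComul x) = G.Δ x :=
  congrArg Subtype.val ((StarAlgEquiv.ofInjective K.cosetInclusion
    K.cosetInclusion_injective).apply_symm_apply ⟨G.Δ x, K.comul_mem_range x⟩)

/-- The action of `G` on `K \ G` given by the coproduct. -/
def quotientAction : Action G K.rightCoset where
  δ := K.cosetComul
  coassoc x := by
    -- The identity is tested in `A ⊗ (A ⊗ A)`, where it becomes coassociativity of `Δ`.
    refine map_id_injective (B := SpatialTensor A A) (f := K.rightCoset.subtype)
      Subtype.val_injective ?_
    have hc : K.cosetInclusion.comp K.cosetComul = G.Δ.comp K.rightCoset.subtype :=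
      StarAlgHom.ext K.cosetInclusion_cosetComul
    have h1 : map K.rightCoset.subtype (StarAlgHom.id ℂ (SpatialTensor A A))
        (assoc (map K.cosetComul (StarAlgHom.id ℂ A) (K.cosetComul x))) =
        assoc (map G.Δ (StarAlgHom.id ℂ A) (G.Δ x)) := by
      have hid : StarAlgHom.id ℂ (SpatialTensor A A) =
          map (StarAlgHom.id ℂ A) (StarAlgHom.id ℂ A) :=
        StarAlgHom.ext fun y => (DFunLike.congr_fun (clm_ext
          (f := homCLM (map (StarAlgHom.id ℂ A) (StarAlgHom.id ℂ A)))
          (g := ContinuousLinearMap.id ℂ _) fun a b => map_tmul _ _ a b) y).symm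
      rw [hid, ← assoc_map, map_map, hc, ← K.cosetInclusion_cosetComul x, map_map]
    have h2 : map K.rightCoset.subtype (StarAlgHom.id ℂ (SpatialTensor A A))
        (map (StarAlgHom.id ℂ K.rightCoset) G.Δ (K.cosetComul x)) =
        map (StarAlgHom.id ℂ A) G.Δ (G.Δ x) := by
      rw [map_map, ← K.cosetInclusion_cosetComul x, map_map]
      rfl
    rw [h1, h2, G.coassoc]

theorem quotientAction_isQuotientAction : K.IsQuotientAction K.quotientAction :=
  K.cosetInclusion_cosetComul

end QuantumSubgroup

/-! ### The orbit map, the stabilizer and injectivity -/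

namespace Action

variable {A C : Type u} [CStarAlgebra A] [CStarAlgebra C] {G : CompactQuantumGroup A}
  (α : Action G C) (χ : C →⋆ₐ[ℂ] ℂ)

theorem charSlice_apply {B : Type u} [CStarAlgebra B] (x : SpatialTensor C B) :
    charSlice χ x = leftSlice (charFunctional χ) x := rfl

/-- `T_χ` intertwines the action with the coproduct. -/
theorem comul_orbitMap (c : C) :
    G.Δ (α.orbitMap χ c) = map (α.orbitMap χ) (StarAlgHom.id ℂ A) (α.δ c) := by
  -- `Δ(χ ⊗ ι)δ = (χ ⊗ ι ⊗ ι)(ι ⊗ Δ)δ = (χ ⊗ ι ⊗ ι)(δ ⊗ ι)δ`, which is `(T_χ ⊗ ι)δ`.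
  have h1 : G.Δ (α.orbitMap χ c) =
      charSlice χ (assoc (map α.δ (StarAlgHom.id ℂ A) (α.δ c))) := by
    rw [α.coassoc, charSlice_apply, leftSlice_map]
    rfl
  have h2 : ∀ y : SpatialTensor (SpatialTensor C A) A,
      charSlice χ (assoc y) = map (charSlice χ) (StarAlgHom.id ℂ A) y := fun y =>
    DFunLike.congr_fun (clm_ext (f := (homCLM (charSlice χ)).comp (homCLM assoc))
      (g := homCLM (map (charSlice χ) (StarAlgHom.id ℂ A))) fun x a => by
        rw [ContinuousLinearMap.comp_apply, homCLM_apply, homCLM_apply, homCLM_apply, map_tmul,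
          charSlice_apply, leftSlice_assoc_tmul, charSlice_apply]
        rfl) y
  rw [h1, h2, map_map]
  rfl

/-- A `*`-homomorphism that trivializes `T_χ` turns `Δ ∘ T_χ` into `1 ⊗ T_χ`. -/
theorem map_comul_orbitMap {B D : Type u} [CStarAlgebra B] [CStarAlgebra D] (π : A →⋆ₐ[ℂ] B)
    (hπ : ∀ c, π (α.orbitMap χ c) = χ c • (1 : B)) (σ : A →⋆ₐ[ℂ] D) (c : C) :
    map π σ (G.Δ (α.orbitMap χ c)) = tmul 1 (σ (α.orbitMap χ c)) := by
  -- In the first leg `π T_χ` produces the scalar `χ(x)`, which moves to the second leg and becomes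
  -- the slice by `χ`.
  have h : ∀ y : SpatialTensor C A, map (π.comp (α.orbitMap χ)) σ y =
      tmul 1 (σ (charSlice χ y)) := fun y =>
    DFunLike.congr_fun (clm_ext (f := homCLM (map (π.comp (α.orbitMap χ)) σ))
      (g := (homCLM (inclRight B D)).comp ((homCLM σ).comp (homCLM (charSlice χ)))) fun x a => by
        change map (π.comp (α.orbitMap χ)) σ (tmul x a) = tmul 1 (σ (charSlice χ (tmul x a)))
        rw [map_tmul, charSlice_tmul, map_smul, tmul_smul, ← smul_tmul, StarAlgHom.comp_apply,
          hπ]) y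
  rw [α.comul_orbitMap, map_map]
  exact h (α.δ c)

/-- The stabilizer ideal as a left ideal. -/
def stabilizerLeftIdeal : Ideal A :=
  (TwoSidedIdeal.asIdeal
    (TwoSidedIdeal.span {a : A | ∃ c : C, a = α.orbitMap χ c - χ c • (1 : A)})).closure

instance isClosed_stabilizerLeftIdeal : IsClosed (α.stabilizerLeftIdeal χ : Set A) :=
  isClosed_closure

instance isTwoSided_stabilizerLeftIdeal : (α.stabilizerLeftIdeal χ).IsTwoSided where
  mul_mem_of_left b ha := map_mem_closure (f := fun x => x * b) (continuous_mul_const b) ha fun _ hx =>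
    TwoSidedIdeal.mul_mem_right _ _ _ hx

/-- The generators are permuted by the involution, since `T_χ` and `χ` preserve it. -/
theorem star_mem_stabilizerLeftIdeal (a : A) (ha : a ∈ α.stabilizerLeftIdeal χ) :
    star a ∈ α.stabilizerLeftIdeal χ := by
  refine map_mem_closure continuous_star ha fun x hx => ?_
  change x ∈ TwoSidedIdeal.span _ at hx
  change star x ∈ TwoSidedIdeal.span _
  induction hx using TwoSidedIdeal.span_induction with
  | mem x hx =>
    obtain ⟨c, rfl⟩ := hx
    refine TwoSidedIdeal.subset_span ⟨star c, ?_⟩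
    rw [star_sub, star_smul, star_one, map_star, map_star]
  | zero => rw [star_zero]; exact zero_mem _
  | add x y _ _ hx hy => rw [star_add]; exact add_mem hx hy
  | neg x _ hx => rw [star_neg]; exact neg_mem hx
  | left_absorb a x _ hx => rw [star_mul]; exact TwoSidedIdeal.mul_mem_right _ _ _ hx
  | right_absorb b x _ hx => rw [star_mul]; exact TwoSidedIdeal.mul_mem_left _ _ _ hx

/-- The kernel of `f` is a closed two-sided ideal containing the generators. -/
theorem eq_zero_of_mem_stabilizerIdeal {B : Type u} [CStarAlgebra B] (f : A →⋆ₐ[ℂ] B)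
    (hf : ∀ c, f (α.orbitMap χ c) = χ c • (1 : B)) {a : A} (ha : a ∈ α.stabilizerIdeal χ) :
    f a = 0 := by
  refine closure_minimal (t := {a | f a = 0}) (fun x hx => ?_)
    (isClosed_eq (continuous_hom f) continuous_const) ha
  refine (TwoSidedIdeal.mem_ker f).mp ((TwoSidedIdeal.span_le (I := TwoSidedIdeal.ker f)).mpr ?_ hx)
  rintro _ ⟨c, rfl⟩
  exact (TwoSidedIdeal.mem_ker f).mpr (by rw [map_sub, hf, map_smul, map_one, sub_self])

theorem exists_stabilizer : ∃ K : QuantumSubgroup G, K.IsStabilizer α χ := by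
  let I := α.stabilizerLeftIdeal χ
  let _ : CStarAlgebra (A ⧸ I) := quotientCStarAlgebra I (α.star_mem_stabilizerLeftIdeal χ)
  let π : A →⋆ₐ[ℂ] A ⧸ I := { Ideal.Quotient.mkₐ ℂ I with map_star' := fun _ => rfl }
  have hker : ∀ a, π a = 0 ↔ a ∈ α.stabilizerIdeal χ := fun a => Ideal.Quotient.eq_zero_iff_mem
  have hπ : ∀ c, π (α.orbitMap χ c) = χ c • (1 : A ⧸ I) := fun c => by
    rw [← sub_eq_zero, ← map_one π, ← map_smul, ← map_sub, hker]
    exact subset_closure (TwoSidedIdeal.subset_span ⟨c, rfl⟩)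
  -- `(π ⊗ π)Δ T_χ(c) = 1 ⊗ π T_χ(c) = χ(c)(1 ⊗ 1)`, so `(π ⊗ π)Δ` trivializes `T_χ` and factors
  -- through the quotient.
  have hΔ : ∀ a ∈ I, (map π π).comp G.Δ a = 0 := fun a ha =>
    α.eq_zero_of_mem_stabilizerIdeal χ _ (fun c => by
      rw [StarAlgHom.comp_apply, α.map_comul_orbitMap χ π hπ, hπ, tmul_smul, one_eq_tmul]) ha
  let Δ' : A ⧸ I →⋆ₐ[ℂ] SpatialTensor (A ⧸ I) (A ⧸ I) :=
    { Ideal.Quotient.liftₐ I ((map π π).comp G.Δ).toAlgHom hΔ with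
      map_star' := by
        rintro ⟨a⟩
        exact map_star ((map π π).comp G.Δ) a }
  exact ⟨{ carrier := A ⧸ I
           Δ' := Δ'
           π := π
           surjective := Ideal.Quotient.mk_surjective
           compat := fun a => rfl }, hker⟩

/-- Averaging an ergodic action over the Haar state yields scalars. -/
theorem rightSlice_haar_eq_smul_one {h : PosFunctional A} (hHaar : G.IsHaarState h)
    (herg : α.IsErgodic) (c : C) : ∃ z : ℂ, rightSlice h (α.δ c) = z • (1 : C) := by
  -- The average is a fixed point: applying `δ` to it gives `(ι ⊗ (ι ⊗ h)Δ)δ(c)`, and invariance of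
  -- `h` turns this into the average tensored with `1`.
  refine herg _ ?_
  have hδ : α.δ (rightSlice h (α.δ c)) = rightSlice h (map α.δ (StarAlgHom.id ℂ A) (α.δ c)) :=
    (rightSlice_map h α.δ (StarAlgHom.id ℂ A) (α.δ c)).symm
  refine sub_eq_zero.mp (eq_zero_of_slices _ fun φ ψ => ?_)
  have e1 : ψ (leftSlice φ (α.δ (rightSlice h (α.δ c)))) = h (leftSlice φ (α.δ c)) * ψ 1 := by
    rw [hδ, ← prodFunctional_apply, ← slice_comm, ← leftSlice_leftSlice_assoc, α.coassoc,
      leftSlice_map, slice_comm, hHaar.right_inv, map_smul, smul_eq_mul]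
    rfl
  rw [map_sub, map_sub, e1, leftSlice_tmul, map_smul, smul_eq_mul, slice_comm, sub_self]

theorem orbitMap_injective {h : PosFunctional A} (hHaar : G.IsHaarState h)
    (hfaithful : h.IsFaithful) (herg : α.IsErgodic) (hinj : Function.Injective α.δ) :
    Function.Injective (α.orbitMap χ) := by
  rw [injective_iff_map_eq_zero]
  intro c hc
  refine (injective_iff_map_eq_zero α.δ).mp hinj c ?_
  obtain ⟨z, hz⟩ := α.rightSlice_haar_eq_smul_one hHaar herg (star c * c)
  -- Applying `χ` to `z 1 = (ι ⊗ h)δ(c* c)` gives `z = h(T_χ(c)* T_χ(c))`.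
  have hz0 : z = 0 := by
    have h1 : h (α.orbitMap χ (star c * c)) = charFunctional χ (rightSlice h (α.δ (star c * c))) :=
      slice_comm (charFunctional χ) h _
    rw [map_mul, hc, mul_zero, map_zero, hz, map_smul] at h1
    have h2 : charFunctional χ 1 = 1 := map_one χ
    rw [h2, smul_eq_mul, mul_one] at h1
    exact h1.symm
  rw [hz0, zero_smul] at hz
  refine eq_zero_of_slices _ fun φ ψ => ?_
  have hnull : prodFunctional φ h (star (α.δ c) * α.δ c) = 0 := by
    rw [← map_star, ← map_mul, prodFunctional_apply, slice_comm, hz, map_zero]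
  -- With `y = (φ ⊗ ι)δ(c)`, `h(y* y) = (φ ⊗ h)((1 ⊗ y*)δ(c))`, which vanishes because `δ(c)` is a
  -- null vector of `φ ⊗ h`.
  have h0 : leftSlice φ (α.δ c) = 0 := by
    refine hfaithful _ ?_
    rw [← leftSlice_one_tmul_mul, ← prodFunctional_apply]
    exact (prodFunctional φ h).mul_eq_zero_of_null hnull _
  rw [h0, map_zero]

end Action

end CQG

end

/-! ### The equivariant embedding -/

theorem mainTheorem1 {A C : Type u} [CStarAlgebra A] [CStarAlgebra C]
    (G : CQG.CompactQuantumGroup A) (h : CQG.PosFunctional A) (hHaar : G.IsHaarState h)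
    (hfaithful : h.IsFaithful)
    (α : CQG.Action G C) (hnondeg : α.IsNondegenerate) (hergodic : α.IsErgodic)
    (hinj : Function.Injective α.δ) (χ : C →⋆ₐ[ℂ] ℂ) :
    (∃ K : CQG.QuantumSubgroup G, K.IsStabilizer α χ) ∧
    ∀ K : CQG.QuantumSubgroup G, K.IsStabilizer α χ →
      ∃ (T : C →⋆ₐ[ℂ] K.rightCoset) (η : CQG.Action G K.rightCoset),
        (∀ c, (T c : A) = α.orbitMap χ c) ∧
        K.IsQuotientAction η ∧
        (∀ c, η.δ (T c) = CQG.SpatialTensor.map T (StarAlgHom.id ℂ A) (α.δ c)) ∧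
        Function.Injective T := by
  refine ⟨α.exists_stabilizer χ, fun K hK => ?_⟩
  have hπ : ∀ c, K.π (α.orbitMap χ c) = χ c • (1 : K.carrier) := fun c => by
    rw [← sub_eq_zero, ← map_one K.π, ← map_smul, ← map_sub, hK]
    exact subset_closure (TwoSidedIdeal.subset_span ⟨c, rfl⟩)
  have hmem : ∀ c, α.orbitMap χ c ∈ K.rightCoset := fun c =>
    α.map_comul_orbitMap χ K.π hπ (StarAlgHom.id ℂ A) c
  let T : C →⋆ₐ[ℂ] K.rightCoset := (α.orbitMap χ).codRestrict K.rightCoset hmem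
  have hT : K.rightCoset.subtype.comp T = α.orbitMap χ := StarAlgHom.ext fun _ => rfl
  refine ⟨T, K.quotientAction, fun _ => rfl, K.quotientAction_isQuotientAction, fun c => ?_, ?_⟩
  -- Equivariance may be checked in `A ⊗ A`, where it is `Δ T_χ = (T_χ ⊗ ι)δ`.
  · refine K.cosetInclusion_injective ?_
    rw [K.quotientAction_isQuotientAction, CQG.SpatialTensor.map_map, hT]
    exact α.comul_orbitMap χ c
  · intro c c' hcc
    exact α.orbitMap_injective χ hHaar hfaithful hergodic hinj (congrArg Subtype.val hcc)
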